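/- **Setting.** Let $\Omega$ be an infinite set of states with a $\sigma$-algebra $\Sigma$ of events (for instance $\Sigma=2^\Omega$), let $\mathbb X$ be an infinite set of potential outcomes, and let $N=\{1,\dots,n\}$, $n\ge 2$. For a countable (finite or infinite) set $X\subset\mathbb X$ with $|X|\ge 2$, let $F_X$ be the set of acts, i.e. functions $f:\Omega\to X$ with finite range and $f^{-1}(x)\in\Sigma$ for all $x$; outcomes are identified with constant acts, and $xEy$ is the act equal to $x$ on the event $E$ and to $y$ off $E$. A preference $R_i$ on $F_X$ is an SEU preference if there are a bounded nonconstant $u_i:X\to\mathbb R$ and a countably additive, nonatomic probability measure $p_i$ on $\Sigma$ with $f\,R_i\,g\iff\int u_i(f)\,dp_i\ge\int u_i(g)\,dp_i$; then $p_i$ is unique and $u_i$ is unique up to positive affine transformations. A problem is a pair $(X,R_N)$ where $R_N=(R_1,\dots,R_n)$ are SEU preferences on $F_X$ such that every individual has a best and a worst outcome in $X$. Let $u_i^*(\cdot;X,R_N)$ be the positive affine transformation of $u_i$ with $\inf_X u^*_i=0$ and $\sup_X u^*_i=1$, and let $U_i^*(f;X,R_N)=\int u_i^*(f(\omega);X,R_N)\,dp_i(\omega)$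 and $U^*=(U_1^*,\dots,U_n^*)$. An aggregation rule $\mathbf R$ assigns to each problem $(X,R_N)$ a complete and transitive relation $\mathbf R(X,R_N)$ on $F_X$. Strict parts are written $P_i$, $\mathbf P$. **Axioms** (each for all problems $(X,R_N)$ and all acts, outcomes and events involved). - *Pareto principle*: if $f R_i g$ for all $i$, then $f\,\mathbf R(X,R_N)\,g$; if $f P_i g$ for all $i$, then $f\,\mathbf P(X,R_N)\,g$. - *Continuity*: if $U^*(f^t;X,R_N)\to U^*(f;X,R_N)$, then $f^t\,\mathbf R(X,R_N)\,g$ for all $t$ implies $f\,\mathbf R(X,R_N)\,g$, and $g\,\mathbf R(X,R_N)\,f^t$ for all $t$ implies $g\,\mathbf R(X,R_N)\,f$. - *Independence of inessential expansion (IIE)*: if $X\subset X'$, $R_N'$ coincides with $R_N$ on $F_X$, and for all $x'\in X'$ and $i\in N$ there are $x_i^+,x_i^-\in X$ with $x_i^+R_i'\,x'\,R_i'\,x_i^-$, then $\mathbf R(X',R'_N)$ coincides with $\mathbf R(X,R_N)$ on $F_X$. - *Weak preference for mixing*: if $p_i(E)=1/2$ for all $i$, then $xEy\,\mathbf R(X,R_N)\,x$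 or $xEy\,\mathbf R(X,R_N)\,y$. - *Belief irrelevance*: if $u_i^*(\cdot;X,R_N)=u_i^*(\cdot;X,R_N')$ for all $i$, then $x\,\mathbf R(X,R_N)\,y\iff x\,\mathbf R(X,R'_N)\,y$ for all $x,y\in X$. - *Weak restricted certainty independence*: if $u_i^*(\cdot;X,R_N)=u_j^*(\cdot;X,R_N)$ for all $i,j$, then for all $f,g\in F_X$, $x,y\in X$ and $\alpha\in(0,1)$, $f_{\alpha x}\,\mathbf R(X,R_N)\,g_{\alpha x}\iff f_{\alpha y}\,\mathbf R(X,R_N)\,g_{\alpha y}$. Here $f_{\alpha x}$ is any act with $p_i(f_{\alpha x}^{-1}(z))=\alpha\,p_i(f^{-1}(z))+(1-\alpha)\mathbf 1_{z=x}$ for all $i\in N$ and $z\in X$. **Theorem 6.** Let $\Delta_N=\{\mu\in[0,1]^N:\sum_i\mu_i=1\}$. An aggregation rule $\mathbf R$ satisfies the Pareto principle, continuity, IIE, weak preference for mixing, belief irrelevance and weak restricted certainty independence if and only if there exists a convex, lower semicontinuous function $\varphi:\Delta_N\to\mathbb R_+\cup\{+\infty\}$ that is grounded ($\inf_{\mu\in\Delta_N}\varphi(\mu)=0$)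 such that for every problem $(X,R_N)$ and all $f,g\in F_X$, $$f\,\mathbf R(X,R_N)\,g\iff W_{(X,R_N)}(f)\ge W_{(X,R_N)}(g),\qquad W_{(X,R_N)}(f)=\min_{\mu\in\Delta_N}\Big\{\sum_{i\in N}\mu_i\,U_i^*(f;X,R_N)+\varphi(\mu)\Big\},$$ the minimum being attained and finite. -/

import Mathlib

open MeasureTheory Filter Topology
open scoped NNReal ENNReal

namespace SocialChoice

/-- A set of feasible outcomes: a countable (finite or infinite) subset of the set `𝕏` of
potentially feasible outcomes, with at least two elements. -/
structure Menu (𝕏 : Type*) where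
  carrier : Set 𝕏
  countable : carrier.Countable
  nontrivial : carrier.Nontrivial

/-- The outcomes of a menu, as a type. -/
abbrev Menu.Outcome {𝕏 : Type*} (X : Menu 𝕏) : Type _ := X.carrier

/-- The (simple) `X`-valued acts: functions from states to outcomes in `X` with finite range, all
of whose fibres are events.  Events are the members of the given σ-algebra on `Ω`; if that is the
power set `⊤`, the condition on the fibres is void. -/
abbrev Act (Ω : Type*) [MeasurableSpace Ω] {𝕏 : Type*} (X : Menu 𝕏) : Type _ :=
  SimpleFunc Ω X.Outcome

/-- The constant act with value `x`. -/
noncomputable abbrev constAct (Ω : Type*) [MeasurableSpace Ω] {𝕏 : Type*} {X : Menu 𝕏}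
    (x : X.Outcome) : Act Ω X :=
  SimpleFunc.const Ω x

open scoped Classical in
/-- The act `xEy`, equal to `x` on the event `E` and to `y` elsewhere. -/
noncomputable def betAct {Ω : Type*} [MeasurableSpace Ω] {𝕏 : Type*} {X : Menu 𝕏}
    (x : X.Outcome) (E : Set Ω) (hE : MeasurableSet E) (y : X.Outcome) : Act Ω X :=
  SimpleFunc.piecewise E hE (constAct Ω x) (constAct Ω y)

/-- For `X ⊆ X'`, an `X`-valued act regarded as an `X'`-valued act. -/
noncomputable def embAct {Ω : Type*} [MeasurableSpace Ω] {𝕏 : Type*} {X X' : Menu 𝕏}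
    (h : X.carrier ⊆ X'.carrier) (f : Act Ω X) : Act Ω X' :=
  f.map (Set.inclusion h)

/-- The admissible beliefs: countably additive, nonatomic probability measures on the events.
Nonatomic means that every event of positive probability contains an event of strictly smaller
positive probability. -/
structure IsBelief {Ω : Type*} [MeasurableSpace Ω] (p : Measure Ω) : Prop where
  prob : IsProbabilityMeasure p
  nonatomic : ∀ A : Set Ω, MeasurableSet A → 0 < p A →
    ∃ B : Set Ω, B ⊆ A ∧ MeasurableSet B ∧ 0 < p B ∧ p B < p A

/-- Subjective expected utility `U(f; u, p)`. -/
noncomputable def seu {Ω : Type*} [MeasurableSpace Ω] {𝕏 : Type*} {X : Menu 𝕏}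
    (u : X.Outcome → ℝ) (p : Measure Ω) (f : Act Ω X) : ℝ :=
  ∫ ω, u (f ω) ∂p

/-- `(u, p)` is a subjective expected utility representation of the relation `R`, with `u` bounded
and nonconstant and `p` a countably additive, nonatomic probability measure. -/
structure IsSEURep {Ω : Type*} [MeasurableSpace Ω] {𝕏 : Type*} {X : Menu 𝕏}
    (R : Act Ω X → Act Ω X → Prop) (u : X.Outcome → ℝ) (p : Measure Ω) : Prop where
  nonconst : ∃ x y, u x ≠ u y
  bounded : ∃ C, ∀ x, |u x| ≤ C
  belief : IsBelief p
  rep : ∀ f g, R f g ↔ seu u p f ≥ seu u p g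

/-- A profile of subjective expected utility preferences over the `X`-valued acts, such that each
individual has a best and a worst outcome in `X`.  (A menu together with such a profile is a
social choice problem.) -/
structure Profile (Ω : Type*) [MeasurableSpace Ω] {𝕏 : Type*} (n : ℕ) (X : Menu 𝕏) where
  pref : Fin n → Act Ω X → Act Ω X → Prop
  isSEU : ∀ i, ∃ u : X.Outcome → ℝ, ∃ p : Measure Ω, IsSEURep (pref i) u p
  exists_best : ∀ i, ∃ x : X.Outcome, ∀ y, pref i (constAct Ω x) (constAct Ω y)
  exists_worst : ∀ i, ∃ x : X.Outcome, ∀ y, pref i (constAct Ω y) (constAct Ω x)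

namespace Profile

variable {Ω : Type*} [MeasurableSpace Ω] {𝕏 : Type*} {n : ℕ} {X : Menu 𝕏}

/-- A value function of individual `i` (unique up to positive affine transformations). -/
noncomputable def value (P : Profile Ω n X) (i : Fin n) : X.Outcome → ℝ :=
  Classical.choose (P.isSEU i)

/-- The (unique) belief of individual `i`. -/
noncomputable def belief (P : Profile Ω n X) (i : Fin n) : Measure Ω :=
  Classical.choose (Classical.choose_spec (P.isSEU i))

theorem isSEURep (P : Profile Ω n X) (i : Fin n) :
    IsSEURep (P.pref i) (P.value i) (P.belief i) :=
  Classical.choose_spec (Classical.choose_spec (P.isSEU i))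

/-- The 0--1 normalized value function of individual `i`: the positive affine transformation of
the value function with infimum `0` and supremum `1`. -/
noncomputable def normValue (P : Profile Ω n X) (i : Fin n) (x : X.Outcome) : ℝ :=
  (P.value i x - ⨅ y, P.value i y) / ((⨆ y, P.value i y) - ⨅ y, P.value i y)

/-- The vector of 0--1 normalized expected utilities of an act. -/
noncomputable def normUtil (P : Profile Ω n X) (f : Act Ω X) (i : Fin n) : ℝ :=
  seu (P.normValue i) (P.belief i) f

/-- All individuals have the same 0--1 normalized value function. -/
def CommonValue (P : Profile Ω n X) : Prop :=
  ∀ i j, P.normValue i = P.normValue j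

/-- `E` has probability `1/2` according to every individual. -/
def IsCoinToss (P : Profile Ω n X) (E : Set Ω) : Prop :=
  ∀ i, (P.belief i).real E = 1 / 2

open scoped Classical in
/-- `h` is a pseudo-mixed act of `f` and `x` with weight `α`: according to every individual, each
outcome has the probability that it has in the mixture giving `f` with probability `α` and `x` with
probability `1 - α`. -/
def IsPseudoMix (P : Profile Ω n X) (α : ℝ) (f : Act Ω X) (x : X.Outcome) (h : Act Ω X) : Prop :=
  ∀ i y, (P.belief i).real (h ⁻¹' {y}) =
    if y = x then α * (P.belief i).real (f ⁻¹' {y}) + (1 - α)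
    else α * (P.belief i).real (f ⁻¹' {y})

/-- The problem `(X', P')` is an inessential expansion of the problem `(X, P)`. -/
structure InessentialExpansion {X' : Menu 𝕏} (P : Profile Ω n X) (P' : Profile Ω n X')
    (h : X.carrier ⊆ X'.carrier) : Prop where
  coincide : ∀ i f g, P'.pref i (embAct h f) (embAct h g) ↔ P.pref i f g
  bounds : ∀ (x' : X'.Outcome) (i : Fin n), ∃ xp xm : X.Outcome,
    P'.pref i (embAct h (constAct Ω xp)) (constAct Ω x') ∧
    P'.pref i (constAct Ω x') (embAct h (constAct Ω xm))

end Profile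

/-- An aggregation rule assigns to each problem a complete and transitive social preference. -/
structure AggregationRule (Ω : Type*) [MeasurableSpace Ω] (𝕏 : Type*) (n : ℕ) where
  rel : ∀ {X : Menu 𝕏}, Profile Ω n X → Act Ω X → Act Ω X → Prop
  complete : ∀ {X : Menu 𝕏} (P : Profile Ω n X) (f g : Act Ω X), rel P f g ∨ rel P g f
  transitive : ∀ {X : Menu 𝕏} (P : Profile Ω n X) (f g h : Act Ω X),
    rel P f g → rel P g h → rel P f h

namespace AggregationRule

variable {Ω : Type*} [MeasurableSpace Ω] {𝕏 : Type*} {n : ℕ}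

/-- Pareto principle. -/
def Pareto (R : AggregationRule Ω 𝕏 n) : Prop :=
  ∀ (X : Menu 𝕏) (P : Profile Ω n X) (f g : Act Ω X),
    ((∀ i, P.pref i f g) → R.rel P f g) ∧
    ((∀ i, P.pref i f g ∧ ¬ P.pref i g f) → (R.rel P f g ∧ ¬ R.rel P g f))

/-- Continuity. -/
def Continuity (R : AggregationRule Ω 𝕏 n) : Prop :=
  ∀ (X : Menu 𝕏) (P : Profile Ω n X) (f g : Act Ω X) (F : ℕ → Act Ω X),
    Tendsto (fun t => P.normUtil (F t)) atTop (𝓝 (P.normUtil f)) →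
    ((∀ t, R.rel P (F t) g) → R.rel P f g) ∧ ((∀ t, R.rel P g (F t)) → R.rel P g f)

/-- Independence of inessential expansion. -/
def IIE (R : AggregationRule Ω 𝕏 n) : Prop :=
  ∀ (X X' : Menu 𝕏) (P : Profile Ω n X) (P' : Profile Ω n X') (h : X.carrier ⊆ X'.carrier),
    P.InessentialExpansion P' h →
    ∀ f g : Act Ω X, R.rel P' (embAct h f) (embAct h g) ↔ R.rel P f g

/-- Weak preference for mixing. -/
def WeakPrefMixing (R : AggregationRule Ω 𝕏 n) : Prop :=
  ∀ (X : Menu 𝕏) (P : Profile Ω n X) (x y : X.Outcome) (E : Set Ω) (hE : MeasurableSet E),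
    P.IsCoinToss E →
    R.rel P (betAct x E hE y) (constAct Ω x) ∨ R.rel P (betAct x E hE y) (constAct Ω y)

/-- Belief irrelevance. -/
def BeliefIrrelevance (R : AggregationRule Ω 𝕏 n) : Prop :=
  ∀ (X : Menu 𝕏) (P P' : Profile Ω n X), P.normValue = P'.normValue →
    ∀ x y : X.Outcome,
      R.rel P (constAct Ω x) (constAct Ω y) ↔ R.rel P' (constAct Ω x) (constAct Ω y)

/-- Weak restricted certainty independence. -/
def WeakRestrictedCertaintyIndep (R : AggregationRule Ω 𝕏 n) : Prop :=
  ∀ (X : Menu 𝕏) (P : Profile Ω n X), P.CommonValue →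
    ∀ (f g : Act Ω X) (x y : X.Outcome) (α : ℝ), 0 < α → α < 1 →
    ∀ fx gx fy gy : Act Ω X,
      P.IsPseudoMix α f x fx → P.IsPseudoMix α g x gx →
      P.IsPseudoMix α f y fy → P.IsPseudoMix α g y gy →
      (R.rel P fx gx ↔ R.rel P fy gy)

end AggregationRule

/-- `φ`, as a function on the simplex of weights, is grounded: its infimum there is `0`. -/
def Grounded {n : ℕ} (φ : (Fin n → ℝ) → ℝ≥0∞) : Prop :=
  ⨅ μ ∈ stdSimplex ℝ (Fin n), φ μ = 0

/-- `w` is the minimum over the weights `μ` of `∑ i, μ i * v i + φ μ` (a minimum that is attained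
and finite). -/
def IsVariationalMin {n : ℕ} (φ : (Fin n → ℝ) → ℝ≥0∞) (v : Fin n → ℝ) (w : ℝ) : Prop :=
  IsLeast ((fun μ : Fin n → ℝ => ((∑ i, μ i * v i : ℝ) : EReal) + ((φ μ : ℝ≥0∞) : EReal)) ''
    stdSimplex ℝ (Fin n)) (w : EReal)

end SocialChoice

/-! The axioms reduce the rule to one ordering of the cube of normalized utility vectors, and that
ordering has a concave, translation-invariant numerical representation, whose conjugate is the
penalty.

Reduction (`rel_iff_of_normUtil_eq`). Inessential expansion allows passing to fresh outcomes, and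
Pareto indifference allows replacing two acts by outcomes that have the same utility vectors. Two
problems with the same utility vectors can thus be moved to one menu with the same value functions,
where they differ only in beliefs; belief irrelevance identifies them. Since normalization is used
in the transfers, one best and one worst outcome per individual must be retained.

The ordering (`exists_isCubeOrder`). Conditioning a nonatomic belief on disjoint events gives
beliefs whose joint range is the whole cube, so every utility vector is realized by a bet between a
commonly best and a commonly worst outcome. In this common-value problem, certainty independence
becomes invariance under adding a constant to all coordinates. A coin toss between two outcomes
produces the midpoint of their utility vectors, so weak preference for mixing becomes midpoint
quasiconcavity.

The representation. By continuity and connectedness of the unit interval each vector is equivalent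
to a constant `W v` (`exists_isCubeWelfare`). Translation invariance upgrades quasiconcavity to
concavity (`IsCubeWelfare.concave`): shifting one of two vectors equalizes their welfare. A
separating hyperplane, again with translation invariance and monotonicity, gives supergradients that
are probability weights (`exists_supergradient`), and the supremum of `W v - ∑ i, μ i * v i` over
the cube is then the required penalty.

Conversely, all axioms follow from testing the minimizing weights for one vector at another vector
(`IsVariationalMin.le_add`, `IsVariationalMin.add_le_midpoint`). -/

namespace SocialChoice

/-! ### Nonatomic measures: intermediate values, uniqueness, joint ranges. -/

section Belief

variable {Ω : Type*} [MeasurableSpace Ω]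

namespace IsBelief

theorem exists_subset_real {p : Measure Ω} (hp : IsBelief p) {A : Set Ω} (hA : MeasurableSet A)
    (h : 0 < p.real A) :
    ∃ B ⊆ A, MeasurableSet B ∧ 0 < p.real B ∧ p.real B < p.real A := by
  have := hp.prob
  have hA0 : 0 < p A := by
    by_contra h0
    have : p A = 0 := by simpa using h0
    simp [Measure.real, this] at h
  obtain ⟨B, hBA, hB, hB0, hlt⟩ := hp.nonatomic A hA hA0
  refine ⟨B, hBA, hB, ENNReal.toReal_pos hB0.ne' (measure_ne_top _ _), ?_⟩
  exact (ENNReal.toReal_lt_toReal (measure_ne_top _ _) (measure_ne_top _ _)).2 hlt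

/-- Repeated halving: a proper piece of positive measure or its complement within the set has at
most half the measure, and both are nonnull. -/
theorem exists_subset_small {p : Measure Ω} (hp : IsBelief p) {A : Set Ω} (hA : MeasurableSet A)
    (h : 0 < p.real A) {ε : ℝ} (hε : 0 < ε) :
    ∃ B ⊆ A, MeasurableSet B ∧ 0 < p.real B ∧ p.real B ≤ ε := by
  have := hp.prob
  have key : ∀ k : ℕ, ∃ B ⊆ A, MeasurableSet B ∧ 0 < p.real B ∧ p.real B ≤ (1 / 2) ^ k := by
    intro k
    induction k with
    | zero => exact ⟨A, subset_rfl, hA, h, by simp⟩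
    | succ k ih =>
      obtain ⟨B, hBA, hB, hB0, hBk⟩ := ih
      obtain ⟨C, hCB, hC, hC0, hCB'⟩ := hp.exists_subset_real hB hB0
      have hd : p.real (B \ C) = p.real B - p.real C := measureReal_sdiff hCB hC
      rcases le_total (p.real C) (p.real B / 2) with hle | hle
      · exact ⟨C, hCB.trans hBA, hC, hC0, by rw [pow_succ]; linarith⟩
      · exact ⟨B \ C, Set.sdiff_subset.trans hBA, hB.diff hC, by linarith,
          by rw [pow_succ]; linarith⟩
  obtain ⟨k, hk⟩ := exists_pow_lt_of_lt_one hε (by norm_num : (1 / 2 : ℝ) < 1)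
  obtain ⟨B, h1, h2, h3, h4⟩ := key k
  exact ⟨B, h1, h2, h3, h4.trans hk.le⟩

/-- Sierpiński's theorem: a nonatomic probability measure takes all intermediate values. -/
theorem exists_subset_real_eq {p : Measure Ω} (hp : IsBelief p) {A : Set Ω} (hA : MeasurableSet A)
    {t : ℝ} (ht0 : 0 ≤ t) (ht : t ≤ p.real A) :
    ∃ B ⊆ A, MeasurableSet B ∧ p.real B = t := by
  have := hp.prob
  let S := {B : Set Ω // B ⊆ A ∧ MeasurableSet B ∧ p.real B ≤ t}
  -- Greedy exhaustion: the supremum of admissible gains need not be attained, so each stage takes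
  -- at least half of the possible gain.
  have step : ∀ B : S, ∃ B' : S, B.1 ⊆ B'.1 ∧ ∀ C : S, B.1 ⊆ C.1 →
      p.real C.1 - p.real B.1 ≤ 2 * (p.real B'.1 - p.real B.1) := by
    intro B
    let V : Set ℝ := {r | ∃ C : S, B.1 ⊆ C.1 ∧ r = p.real C.1}
    have hV : V.Nonempty := ⟨_, B, subset_rfl, rfl⟩
    have hVb : BddAbove V := ⟨t, by rintro r ⟨C, -, rfl⟩; exact C.2.2.2⟩
    have hBV : p.real B.1 ≤ sSup V := le_csSup hVb ⟨B, subset_rfl, rfl⟩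
    rcases hBV.eq_or_lt with heq | hlt
    · refine ⟨B, subset_rfl, fun C hC => ?_⟩
      have : p.real C.1 ≤ sSup V := le_csSup hVb ⟨C, hC, rfl⟩
      linarith
    · obtain ⟨r, ⟨B', hBB', rfl⟩, hr⟩ :=
        exists_lt_of_lt_csSup hV (by linarith : (p.real B.1 + sSup V) / 2 < sSup V)
      refine ⟨B', hBB', fun C hC => ?_⟩
      have : p.real C.1 ≤ sSup V := le_csSup hVb ⟨C, hC, rfl⟩
      linarith
  choose nxt hsub hnxt using step
  let s : ℕ → S := fun k => Nat.rec ⟨∅, by simp [ht0]⟩ (fun _ B => nxt B) k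
  have hs : ∀ k, s (k + 1) = nxt (s k) := fun k => rfl
  have hmono : Monotone fun k => (s k).1 := monotone_nat_of_le_succ fun k => by
    rw [hs]; exact hsub _
  have hlim : Tendsto (fun k => p.real (s k).1) atTop (𝓝 (p.real (⋃ k, (s k).1))) :=
    (ENNReal.tendsto_toReal (measure_ne_top _ _)).comp (tendsto_measure_iUnion_atTop hmono)
  have hU : MeasurableSet (⋃ k, (s k).1) := MeasurableSet.iUnion fun k => (s k).2.2.1
  have hUA : (⋃ k, (s k).1) ⊆ A := Set.iUnion_subset fun k => (s k).2.1
  have hUt : p.real (⋃ k, (s k).1) ≤ t := le_of_tendsto' hlim fun k => (s k).2.2.2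
  refine ⟨_, hUA, hU, ?_⟩
  by_contra hne
  have hlt : p.real (⋃ k, (s k).1) < t := lt_of_le_of_ne hUt hne
  have hrest : p.real (A \ ⋃ k, (s k).1) = p.real A - p.real (⋃ k, (s k).1) :=
    measureReal_sdiff hUA hU
  obtain ⟨D, hDA, hD, hD0, hDt⟩ := hp.exists_subset_small (hA.diff hU)
    (by linarith) (sub_pos.2 hlt)
  have hdisj : Disjoint (⋃ k, (s k).1) D :=
    Set.disjoint_left.2 fun x hx hxD => (hDA hxD).2 hx
  have hUD := measureReal_union (μ := p) hdisj hD
  -- `C` was an admissible enlargement at every stage. The greedy gains tend to zero, so `C` cannot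
  -- exceed the union in measure, although `D` is nonnull.
  let C : S := ⟨(⋃ k, (s k).1) ∪ D, Set.union_subset hUA (hDA.trans Set.sdiff_subset),
    hU.union hD, by linarith⟩
  have hC : ∀ k, p.real C.1 - p.real (s k).1 ≤ 2 * (p.real (s (k + 1)).1 - p.real (s k).1) :=
    fun k => hnxt (s k) C ((Set.subset_iUnion (fun k => (s k).1) k).trans Set.subset_union_left)
  have h1 := le_of_tendsto_of_tendsto' (hlim.const_sub (p.real C.1))
    (((hlim.comp (tendsto_add_atTop_nat 1)).sub hlim).const_mul 2) hC
  have h2 : p.real C.1 = p.real (⋃ k, (s k).1) + p.real D := hUD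
  simp only [sub_self, mul_zero] at h1
  linarith

/-- A nonatomic probability measure is determined by its qualitative ordering of the events. -/
theorem eq_of_order {p q : Measure Ω} (hp : IsBelief p) (hq : IsBelief q)
    (h : ∀ A B, MeasurableSet A → MeasurableSet B → (p.real A ≤ p.real B ↔ q.real A ≤ q.real B)) :
    p = q := by
  have := hp.prob
  have := hq.prob
  have hex : ∀ t : ℝ, ∃ B, MeasurableSet B ∧ (0 ≤ t → t ≤ 1 → p.real B = t) := by
    intro t
    by_cases ht : 0 ≤ t ∧ t ≤ 1
    · obtain ⟨B, -, hB, hBt⟩ := hp.exists_subset_real_eq MeasurableSet.univ ht.1 (by simpa using ht.2)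
      exact ⟨B, hB, fun _ _ => hBt⟩
    · exact ⟨∅, MeasurableSet.empty, fun h1 h2 => absurd ⟨h1, h2⟩ ht⟩
  choose E hE hpE using hex
  have hEq : ∀ A B, MeasurableSet A → MeasurableSet B → p.real A = p.real B →
      q.real A = q.real B := fun A B hA hB hAB =>
    le_antisymm ((h A B hA hB).1 hAB.le) ((h B A hB hA).1 hAB.ge)
  have hadd : ∀ a b : ℝ, 0 ≤ a → 0 ≤ b → a + b ≤ 1 →
      q.real (E (a + b)) = q.real (E a) + q.real (E b) := by
    intro a b ha hb hab
    have hpab := hpE (a + b) (by linarith) hab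
    obtain ⟨B, hBE, hB, hBa⟩ := hp.exists_subset_real_eq (hE (a + b)) ha (by linarith)
    have h1 : p.real (E (a + b) \ B) = _ := measureReal_sdiff hBE hB
    have h2 : q.real (E (a + b) \ B) = _ := measureReal_sdiff hBE hB
    have h3 := hEq B (E a) hB (hE a) (by rw [hBa, hpE a ha (by linarith)])
    have h4 := hEq _ (E b) ((hE (a + b)).diff hB) (hE b)
      (by rw [h1, hBa, hpab, hpE b hb (by linarith)]; ring)
    linarith
  have h1 : q.real (E 1) = 1 := by
    have := hEq (E 1) Set.univ (hE 1) MeasurableSet.univ (by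
      rw [hpE 1 zero_le_one le_rfl, probReal_univ])
    rw [this, probReal_univ]
  have h0 : q.real (E 0) = 0 := by
    have := hadd 0 0 le_rfl le_rfl (by norm_num)
    rw [add_zero] at this
    linarith
  have hmul : ∀ (m : ℕ) (r : ℝ), 0 ≤ r → m * r ≤ 1 → q.real (E (m * r)) = m * q.real (E r) := by
    intro m r hr
    induction m with
    | zero => intro _; simp [h0]
    | succ m ih =>
      intro hm
      push_cast at hm ⊢
      have hmr : (m : ℝ) * r ≤ 1 := by nlinarith
      have := hadd (m * r) r (by positivity) hr (by linarith)
      rw [add_mul, one_mul, this, ih hmr]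
      ring
  have hdiv : ∀ m k : ℕ, 0 < m → k ≤ m → q.real (E (k * (1 / m))) = k * (1 / m) := by
    intro m k hm hkm
    have hm' : (0 : ℝ) < m := by exact_mod_cast hm
    have e1 := hmul m (1 / m) (by positivity) (by rw [mul_one_div_cancel hm'.ne'])
    rw [mul_one_div_cancel hm'.ne', h1] at e1
    have e2 := hmul k (1 / m) (by positivity) (by
      rw [mul_one_div, div_le_one hm']; exact_mod_cast hkm)
    rw [e2]
    congr 1
    field_simp
    linarith
  have hreal : ∀ A, MeasurableSet A → ∀ m : ℕ, 0 < m → |p.real A - q.real A| ≤ 1 / m := by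
    intro A hA m hm
    have hm' : (0 : ℝ) < m := by exact_mod_cast hm
    have hp0 : 0 ≤ p.real A := measureReal_nonneg
    have hp1 : p.real A ≤ 1 := measureReal_le_one
    have hq1 : q.real A ≤ 1 := measureReal_le_one
    have hk0 := Nat.floor_le (mul_nonneg hm'.le hp0)
    have hk1 := Nat.lt_floor_add_one ((m : ℝ) * p.real A)
    set k := ⌊(m : ℝ) * p.real A⌋₊
    have hkm : k ≤ m := by
      have : (k : ℝ) ≤ m := hk0.trans (by nlinarith)
      exact_mod_cast this
    have hlo : (k : ℝ) * (1 / m) ≤ p.real A := by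
      rw [mul_one_div, div_le_iff₀ hm']; linarith
    have hlo' : (k : ℝ) * (1 / m) ≤ q.real A := by
      rw [← hdiv m k hm hkm]
      refine (h _ _ (hE _) hA).1 ?_
      rwa [hpE _ (by positivity) (hlo.trans hp1)]
    have hhi : p.real A ≤ (k : ℝ) * (1 / m) + 1 / m := by
      rw [← add_one_mul, mul_one_div, le_div_iff₀ hm']; linarith
    have hhi' : q.real A ≤ (k : ℝ) * (1 / m) + 1 / m := by
      -- The yardstick for `(k + 1) / m` exists only when `k < m`; otherwise the bound is already at
      -- least 1.
      rcases Nat.lt_or_ge k m with hlt | hge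
      · have e := hdiv m (k + 1) hm hlt
        push_cast at e
        rw [add_one_mul] at e
        rw [← e]
        refine (h _ _ hA (hE _)).1 ?_
        rwa [hpE _ (by positivity)]
        rw [← add_one_mul, mul_one_div, div_le_one hm']
        exact_mod_cast hlt
      · have : (m : ℝ) * (1 / m) ≤ k * (1 / m) := by gcongr
        rw [mul_one_div_cancel hm'.ne'] at this
        have : (0 : ℝ) < 1 / m := by positivity
        linarith
    rw [abs_le]
    constructor <;> linarith
  refine Measure.ext fun A hA => ?_
  have : p.real A = q.real A := by
    by_contra hne
    have hpos : 0 < |p.real A - q.real A| := abs_pos.2 (sub_ne_zero.2 hne)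
    obtain ⟨m, hm⟩ := exists_nat_one_div_lt hpos
    have := hreal A hA (m + 1) m.succ_pos
    push_cast at this
    linarith
  exact (ENNReal.toReal_eq_toReal_iff' (measure_ne_top _ _) (measure_ne_top _ _)).1 this

/-- Conditioning on an event of positive probability gives a belief. -/
theorem cond {p : Measure Ω} (hp : IsBelief p) {A : Set Ω} (hA : MeasurableSet A)
    (hA0 : 0 < p.real A) : IsBelief (ProbabilityTheory.cond p A) := by
  have := hp.prob
  have hpA : p A ≠ 0 := fun h => by simp [Measure.real, h] at hA0
  have hinv0 : (p A)⁻¹ ≠ 0 := ENNReal.inv_ne_zero.2 (measure_ne_top _ _)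
  have hinvt : (p A)⁻¹ ≠ ∞ := ENNReal.inv_ne_top.2 hpA
  refine ⟨ProbabilityTheory.cond_isProbabilityMeasure hpA, fun B hB hB0 => ?_⟩
  rw [ProbabilityTheory.cond_apply hA] at hB0
  obtain ⟨C, hCB, hC, hC0, hClt⟩ := hp.nonatomic (A ∩ B) (hA.inter hB)
    (pos_of_ne_zero fun h => by simp [h] at hB0)
  refine ⟨C, hCB.trans Set.inter_subset_right, hC, ?_, ?_⟩
  · rw [ProbabilityTheory.cond_apply hA, Set.inter_eq_right.2 (hCB.trans Set.inter_subset_left)]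
    exact ENNReal.mul_pos hinv0 hC0.ne'
  · rw [ProbabilityTheory.cond_apply hA, ProbabilityTheory.cond_apply hA,
      Set.inter_eq_right.2 (hCB.trans Set.inter_subset_left)]
    exact ENNReal.mul_lt_mul_right hinv0 hinvt hClt

/-- A proper nonnull piece is split off, and the construction continues inside what remains, which
is still nonnull. -/
theorem exists_disjoint_family {p : Measure Ω} (hp : IsBelief p) (n : ℕ) :
    ∃ A : Fin n → Set Ω, (∀ i, MeasurableSet (A i)) ∧ (∀ i, 0 < p.real (A i)) ∧
      Pairwise (Function.onFun Disjoint A) := by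
  have := hp.prob
  suffices H : ∀ n : ℕ, ∀ B : Set Ω, MeasurableSet B → 0 < p.real B →
      ∃ A : Fin n → Set Ω, (∀ i, MeasurableSet (A i)) ∧ (∀ i, 0 < p.real (A i)) ∧
        (∀ i, A i ⊆ B) ∧ Pairwise (Function.onFun Disjoint A) by
    obtain ⟨A, h1, h2, -, h3⟩ := H n Set.univ MeasurableSet.univ (by simp)
    exact ⟨A, h1, h2, h3⟩
  intro n
  induction n with
  | zero => exact fun B _ _ => ⟨fun _ => ∅, fun i => i.elim0, fun i => i.elim0, fun i => i.elim0,
      fun i => i.elim0⟩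
  | succ n ih =>
    intro B hB hB0
    obtain ⟨C, hCB, hC, hC0, hlt⟩ := hp.exists_subset_real hB hB0
    have hd : p.real (B \ C) = p.real B - p.real C := measureReal_sdiff hCB hC
    obtain ⟨A, h1, h2, h3, h4⟩ := ih (B \ C) (hB.diff hC) (by linarith)
    refine ⟨Fin.cons C A, fun i => ?_, fun i => ?_, fun i => ?_, fun i j hij => ?_⟩
    · cases i using Fin.cases <;> simp [hC, h1]
    · cases i using Fin.cases <;> simp [hC0, h2]
    · cases i using Fin.cases
      · simpa using hCB
      · simpa using (h3 _).trans Set.sdiff_subset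
    · have hdis : ∀ j, Disjoint C (A j) := fun j =>
        Set.disjoint_left.2 fun x hx hxA => (h3 j hxA).2 hx
      cases i using Fin.cases with
      | zero => cases j using Fin.cases with
        | zero => exact absurd rfl hij
        | succ j => simpa [Function.onFun] using hdis j
      | succ i => cases j using Fin.cases with
        | zero => simpa [Function.onFun] using (hdis i).symm
        | succ j =>
          simpa [Function.onFun] using h4 (fun h => hij (by rw [h]))

/-- There are beliefs whose joint range is the whole unit cube. -/
theorem exists_joint_range {p : Measure Ω} (hp : IsBelief p) (n : ℕ) :
    ∃ q : Fin n → Measure Ω, (∀ i, IsBelief (q i)) ∧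
      ∀ v : Fin n → ℝ, (∀ i, v i ∈ Set.Icc (0 : ℝ) 1) →
        ∃ E, MeasurableSet E ∧ ∀ i, (q i).real E = v i := by
  have := hp.prob
  obtain ⟨A, hA, hA0, hdis⟩ := hp.exists_disjoint_family n
  -- Each individual is certain of a private event `A i`. The events are disjoint, so the share of
  -- each can be chosen independently.
  refine ⟨fun i => ProbabilityTheory.cond p (A i), fun i => hp.cond (hA i) (hA0 i),
    fun v hv => ?_⟩
  have hB : ∀ i, ∃ B ⊆ A i, MeasurableSet B ∧ p.real B = v i * p.real (A i) := fun i =>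
    hp.exists_subset_real_eq (hA i) (mul_nonneg (hv i).1 (hA0 i).le)
      (mul_le_of_le_one_left (hA0 i).le (hv i).2)
  choose B hBA hB hBv using hB
  refine ⟨⋃ i, B i, MeasurableSet.iUnion hB, fun i => ?_⟩
  have hAB : A i ∩ ⋃ j, B j = B i := by
    ext x
    simp only [Set.mem_inter_iff, Set.mem_iUnion]
    constructor
    · rintro ⟨hx, j, hj⟩
      by_cases hij : i = j
      · rwa [hij]
      · exact absurd (hBA j hj) (Set.disjoint_left.1 (hdis hij) hx)
    · exact fun hx => ⟨hBA i hx, i, hx⟩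
  change (ProbabilityTheory.cond p (A i) _).toReal = v i
  rw [ProbabilityTheory.cond_apply (hA i), hAB, ENNReal.toReal_mul, ENNReal.toReal_inv]
  change (p.real (A i))⁻¹ * p.real (B i) = v i
  rw [hBv]
  have := (hA0 i).ne'
  field_simp

end IsBelief

end Belief

/-! ### Expected utility: normalization, uniqueness, expansions of menus. -/

section SEU

variable {Ω : Type*} [MeasurableSpace Ω] {𝕏 : Type*} {n : ℕ} {X : Menu 𝕏}

theorem integrable_act {p : Measure Ω} [IsFiniteMeasure p] (u : X.Outcome → ℝ) (f : Act Ω X) :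
    Integrable (fun ω => u (f ω)) p :=
  (f.map u).integrable_of_isFiniteMeasure

@[simp]
theorem seu_constAct (u : X.Outcome → ℝ) (p : Measure Ω) [IsProbabilityMeasure p]
    (x : X.Outcome) : seu u p (constAct Ω x) = u x := by
  simp [seu]

theorem seu_betAct (u : X.Outcome → ℝ) (p : Measure Ω) [IsProbabilityMeasure p]
    (x y : X.Outcome) {E : Set Ω} (hE : MeasurableSet E) :
    seu u p (betAct x E hE y) = u y + p.real E * (u x - u y) := by
  have h : (fun ω => u (betAct x E hE y ω)) =
      fun ω => u y + E.indicator (fun _ => u x - u y) ω := by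
    funext ω
    by_cases hω : ω ∈ E <;> simp [betAct, hω]
  rw [seu, h, integral_add (integrable_const _) ((integrable_const _).indicator hE),
    integral_indicator_const _ hE]
  simp

theorem seu_eq_sum (u : X.Outcome → ℝ) (p : Measure Ω) [IsProbabilityMeasure p] (f : Act Ω X)
    {S : Finset X.Outcome} (hS : ∀ ω, f ω ∈ S) :
    seu u p f = ∑ y ∈ S, p.real (f ⁻¹' {y}) * u y := by
  classical
  have h : (fun ω => u (f ω)) = fun ω => ∑ y ∈ S, (f ⁻¹' {y}).indicator (fun _ => u y) ω := by
    funext ω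
    rw [Finset.sum_eq_single (f ω)]
    · simp
    · intro y _ hy
      exact Set.indicator_of_notMem (fun h => hy h.symm) _
    · exact fun h => absurd (hS ω) h
  rw [seu, h, integral_finsetSum _ fun y _ =>
    (integrable_const _).indicator (f.measurableSet_fiber y)]
  refine Finset.sum_congr rfl fun y _ => ?_
  rw [integral_indicator_const _ (f.measurableSet_fiber y), smul_eq_mul]

theorem seu_affine (u : X.Outcome → ℝ) (p : Measure Ω) [IsProbabilityMeasure p] (f : Act Ω X)
    (a b : ℝ) : seu (fun x => (u x - a) / b) p f = (seu u p f - a) / b := by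
  rw [seu, integral_div, integral_sub (integrable_act u f) (integrable_const _)]
  simp [seu]

theorem seu_embAct {X' : Menu 𝕏} (h : X.carrier ⊆ X'.carrier) (u : X'.Outcome → ℝ)
    (p : Measure Ω) (f : Act Ω X) :
    seu u p (embAct h f) = seu (fun x => u (Set.inclusion h x)) p f := rfl

theorem seu_mem_Icc {u : X.Outcome → ℝ} {p : Measure Ω} [IsProbabilityMeasure p]
    (hu : ∀ x, u x ∈ Set.Icc (0 : ℝ) 1) (f : Act Ω X) : seu u p f ∈ Set.Icc (0 : ℝ) 1 := by
  refine ⟨integral_nonneg fun ω => (hu _).1, ?_⟩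
  calc seu u p f ≤ ∫ _, (1 : ℝ) ∂p :=
        integral_mono (integrable_act u f) (integrable_const _) fun ω => (hu _).2
    _ = 1 := by simp

/-- The value function of an SEU representation is unique up to normalization, the belief is
unique. -/
theorem IsSEURep.unique {R : Act Ω X → Act Ω X → Prop} {u v : X.Outcome → ℝ} {p q : Measure Ω}
    (hu : IsSEURep R u p) (hv : IsSEURep R v q) (hu01 : ∀ x, u x ∈ Set.Icc (0 : ℝ) 1)
    (hv01 : ∀ x, v x ∈ Set.Icc (0 : ℝ) 1) {a b : X.Outcome}
    (hua : u a = 1) (hub : u b = 0) (hva : ∃ a, v a = 1) (hvb : ∃ b, v b = 0) :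
    u = v ∧ p = q := by
  have := hu.belief.prob
  have := hv.belief.prob
  have hcmp : ∀ f g, seu u p f ≥ seu u p g ↔ seu v q f ≥ seu v q g := fun f g =>
    (hu.rep f g).symm.trans (hv.rep f g)
  have hva : v a = 1 := by
    obtain ⟨a', ha'⟩ := hva
    refine le_antisymm (hv01 a).2 ?_
    have := (hcmp (constAct Ω a) (constAct Ω a')).1 (by simpa [hua] using (hu01 a').2)
    simpa [ha'] using this
  have hvb : v b = 0 := by
    obtain ⟨b', hb'⟩ := hvb
    refine le_antisymm ?_ (hv01 b).1
    have := (hcmp (constAct Ω b') (constAct Ω b)).1 (by simpa [hub] using (hu01 b').1)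
    simpa [hb'] using this
  -- Bets with prizes `a` and `b` reveal the ordering of events by probability.
  have hpq : p = q := by
    refine hu.belief.eq_of_order hv.belief fun A B hA hB => ?_
    have := hcmp (betAct a B hB b) (betAct a A hA b)
    simpa [seu_betAct, hua, hub, hva, hvb] using this
  subst hpq
  refine ⟨funext fun x => ?_, rfl⟩
  -- An event of probability `u x` makes the bet on it indifferent to `x`; reading this indifference
  -- in `v` gives `v x = u x`.
  obtain ⟨E, -, hE, hEx⟩ := hu.belief.exists_subset_real_eq MeasurableSet.univ (hu01 x).1
    (by simpa using (hu01 x).2)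
  have h1 := (hcmp (constAct Ω x) (betAct a E hE b)).1 (by simp [seu_betAct, hua, hub, hEx])
  have h2 := (hcmp (betAct a E hE b) (constAct Ω x)).1 (by simp [seu_betAct, hua, hub, hEx])
  simp only [seu_betAct, hva, hvb, hEx, seu_constAct] at h1 h2
  linarith

namespace Profile

instance isProbabilityMeasure_belief (P : Profile Ω n X) (i : Fin n) :
    IsProbabilityMeasure (P.belief i) :=
  (P.isSEURep i).belief.prob

theorem exists_isGreatest_value (P : Profile Ω n X) (i : Fin n) :
    ∃ x, ∀ y, P.value i y ≤ P.value i x := by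
  obtain ⟨x, hx⟩ := P.exists_best i
  exact ⟨x, fun y => by simpa using ((P.isSEURep i).rep _ _).1 (hx y)⟩

theorem exists_isLeast_value (P : Profile Ω n X) (i : Fin n) :
    ∃ x, ∀ y, P.value i x ≤ P.value i y := by
  obtain ⟨x, hx⟩ := P.exists_worst i
  exact ⟨x, fun y => by simpa using ((P.isSEURep i).rep _ _).1 (hx y)⟩

/-- Best and worst outcomes attain the supremum and infimum, so the normalization can be written
with two actual outcomes. -/
theorem exists_normValue_eq (P : Profile Ω n X) (i : Fin n) :
    ∃ a b : X.Outcome, P.value i b < P.value i a ∧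
      (∀ y, P.value i y ≤ P.value i a) ∧ (∀ y, P.value i b ≤ P.value i y) ∧
      ∀ x, P.normValue i x = (P.value i x - P.value i b) / (P.value i a - P.value i b) := by
  obtain ⟨a, ha⟩ := P.exists_isGreatest_value i
  obtain ⟨b, hb⟩ := P.exists_isLeast_value i
  have : Nonempty X.Outcome := ⟨a⟩
  have hsup : ⨆ y, P.value i y = P.value i a :=
    le_antisymm (ciSup_le ha) (le_ciSup (f := P.value i) ⟨_, by rintro _ ⟨y, rfl⟩; exact ha y⟩ a)
  have hinf : ⨅ y, P.value i y = P.value i b :=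
    le_antisymm (ciInf_le (f := P.value i) ⟨_, by rintro _ ⟨y, rfl⟩; exact hb y⟩ b) (le_ciInf hb)
  refine ⟨a, b, ?_, ha, hb, fun x => by rw [normValue, hsup, hinf]⟩
  by_contra hle
  obtain ⟨x, y, hxy⟩ := (P.isSEURep i).nonconst
  apply hxy
  have := ha x; have := ha y; have := hb x; have := hb y
  linarith

theorem normValue_mem_Icc (P : Profile Ω n X) (i : Fin n) (x : X.Outcome) :
    P.normValue i x ∈ Set.Icc (0 : ℝ) 1 := by
  obtain ⟨a, b, hlt, ha, hb, h⟩ := P.exists_normValue_eq i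
  rw [h, Set.mem_Icc, div_le_one (sub_pos.2 hlt)]
  exact ⟨div_nonneg (sub_nonneg.2 (hb x)) (sub_pos.2 hlt).le, by linarith [ha x]⟩

theorem exists_normValue_eq_one (P : Profile Ω n X) (i : Fin n) : ∃ x, P.normValue i x = 1 := by
  obtain ⟨a, b, hlt, ha, hb, h⟩ := P.exists_normValue_eq i
  exact ⟨a, by rw [h, div_self (sub_pos.2 hlt).ne']⟩

theorem exists_normValue_eq_zero (P : Profile Ω n X) (i : Fin n) : ∃ x, P.normValue i x = 0 := by
  obtain ⟨a, b, hlt, ha, hb, h⟩ := P.exists_normValue_eq i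
  exact ⟨b, by rw [h, sub_self, zero_div]⟩

theorem pref_iff_normUtil (P : Profile Ω n X) (i : Fin n) (f g : Act Ω X) :
    P.pref i f g ↔ P.normUtil g i ≤ P.normUtil f i := by
  obtain ⟨a, b, hlt, ha, hb, h⟩ := P.exists_normValue_eq i
  rw [(P.isSEURep i).rep, normUtil, normUtil, funext h, seu_affine, seu_affine,
    div_le_div_iff_of_pos_right (sub_pos.2 hlt)]
  simp

theorem isSEURep_normValue (P : Profile Ω n X) (i : Fin n) :
    IsSEURep (P.pref i) (P.normValue i) (P.belief i) where
  nonconst := by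
    obtain ⟨x, hx⟩ := P.exists_normValue_eq_one i
    obtain ⟨y, hy⟩ := P.exists_normValue_eq_zero i
    exact ⟨x, y, by simp [hx, hy]⟩
  bounded := ⟨1, fun x => abs_le.2
    ⟨by linarith [(P.normValue_mem_Icc i x).1], (P.normValue_mem_Icc i x).2⟩⟩
  belief := (P.isSEURep i).belief
  rep := P.pref_iff_normUtil i

theorem normUtil_mem_Icc (P : Profile Ω n X) (f : Act Ω X) (i : Fin n) :
    P.normUtil f i ∈ Set.Icc (0 : ℝ) 1 :=
  seu_mem_Icc (P.normValue_mem_Icc i) f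

@[simp]
theorem normUtil_constAct (P : Profile Ω n X) (x : X.Outcome) (i : Fin n) :
    P.normUtil (constAct Ω x) i = P.normValue i x := by
  simp [normUtil]

theorem eq_normValue_belief (P : Profile Ω n X) (i : Fin n) {u : X.Outcome → ℝ} {p : Measure Ω}
    (h : IsSEURep (P.pref i) u p) (hu : ∀ x, u x ∈ Set.Icc (0 : ℝ) 1)
    (h1 : ∃ x, u x = 1) (h0 : ∃ x, u x = 0) : P.normValue i = u ∧ P.belief i = p := by
  obtain ⟨a, ha⟩ := P.exists_normValue_eq_one i
  obtain ⟨b, hb⟩ := P.exists_normValue_eq_zero i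
  exact (P.isSEURep_normValue i).unique h (P.normValue_mem_Icc i) hu ha hb h1 h0

/-- The profile with given normalized value functions and beliefs. -/
noncomputable def ofValues (u : Fin n → X.Outcome → ℝ) (p : Fin n → Measure Ω)
    (hu : ∀ i x, u i x ∈ Set.Icc (0 : ℝ) 1) (h1 : ∀ i, ∃ x, u i x = 1) (h0 : ∀ i, ∃ x, u i x = 0)
    (hp : ∀ i, IsBelief (p i)) : Profile Ω n X where
  pref i f g := seu (u i) (p i) f ≥ seu (u i) (p i) g
  isSEU i := by
    obtain ⟨x, hx⟩ := h1 i
    obtain ⟨y, hy⟩ := h0 i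
    exact ⟨u i, p i, ⟨x, y, by simp [hx, hy]⟩,
      ⟨1, fun x => abs_le.2 ⟨by linarith [(hu i x).1], (hu i x).2⟩⟩, hp i, fun _ _ => Iff.rfl⟩
  exists_best i := by
    have := (hp i).prob
    obtain ⟨x, hx⟩ := h1 i
    exact ⟨x, fun y => by simpa [hx] using (hu i y).2⟩
  exists_worst i := by
    have := (hp i).prob
    obtain ⟨x, hx⟩ := h0 i
    exact ⟨x, fun y => by simpa [hx] using (hu i y).1⟩

section ofValues

variable {u : Fin n → X.Outcome → ℝ} {p : Fin n → Measure Ω}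
    (hu : ∀ i x, u i x ∈ Set.Icc (0 : ℝ) 1) (h1 : ∀ i, ∃ x, u i x = 1) (h0 : ∀ i, ∃ x, u i x = 0)
    (hp : ∀ i, IsBelief (p i))

theorem isSEURep_ofValues (i : Fin n) :
    IsSEURep ((ofValues u p hu h1 h0 hp).pref i) (u i) (p i) where
  nonconst := by
    obtain ⟨x, hx⟩ := h1 i
    obtain ⟨y, hy⟩ := h0 i
    exact ⟨x, y, by simp [hx, hy]⟩
  bounded := ⟨1, fun x => abs_le.2 ⟨by linarith [(hu i x).1], (hu i x).2⟩⟩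
  belief := hp i
  rep _ _ := Iff.rfl

@[simp]
theorem normValue_ofValues : (ofValues u p hu h1 h0 hp).normValue = u :=
  funext fun i => (eq_normValue_belief _ i (isSEURep_ofValues hu h1 h0 hp i) (hu i) (h1 i)
    (h0 i)).1

@[simp]
theorem belief_ofValues : (ofValues u p hu h1 h0 hp).belief = p :=
  funext fun i => (eq_normValue_belief _ i (isSEURep_ofValues hu h1 h0 hp i) (hu i) (h1 i)
    (h0 i)).2

end ofValues

/-- `P'` extends `P`: it has the same beliefs, and the same normalized values on the smaller
menu. -/
structure Extends {X' : Menu 𝕏} (P' : Profile Ω n X') (P : Profile Ω n X)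
    (h : X.carrier ⊆ X'.carrier) : Prop where
  belief : P'.belief = P.belief
  normValue : ∀ i x, P'.normValue i (Set.inclusion h x) = P.normValue i x

theorem Extends.normUtil {X' : Menu 𝕏} {P' : Profile Ω n X'} {P : Profile Ω n X}
    {h : X.carrier ⊆ X'.carrier} (hP : P'.Extends P h) (f : Act Ω X) :
    P'.normUtil (embAct h f) = P.normUtil f := by
  funext i
  rw [Profile.normUtil, Profile.normUtil, seu_embAct, hP.belief, funext (hP.normValue i)]

theorem Extends.inessentialExpansion {X' : Menu 𝕏} {P' : Profile Ω n X'} {P : Profile Ω n X}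
    {h : X.carrier ⊆ X'.carrier} (hP : P'.Extends P h) : P.InessentialExpansion P' h where
  coincide i f g := by rw [pref_iff_normUtil, pref_iff_normUtil, hP.normUtil, hP.normUtil]
  bounds x' i := by
    obtain ⟨a, ha⟩ := P.exists_normValue_eq_one i
    obtain ⟨b, hb⟩ := P.exists_normValue_eq_zero i
    refine ⟨a, b, ?_, ?_⟩ <;> rw [pref_iff_normUtil, hP.normUtil, normUtil_constAct,
      normUtil_constAct]
    · exact ha ▸ (P'.normValue_mem_Icc i x').2
    · exact hb ▸ (P'.normValue_mem_Icc i x').1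

/-- The bounds place outcomes of value 0 and 1 inside the smaller menu. The larger normalized value,
restricted, is therefore already normalized, and uniqueness of the representation applies. -/
theorem InessentialExpansion.extends {X' : Menu 𝕏} {P' : Profile Ω n X'} {P : Profile Ω n X}
    {h : X.carrier ⊆ X'.carrier} (hP : P.InessentialExpansion P' h) : P'.Extends P h := by
  have key : ∀ i, P.normValue i = (fun x => P'.normValue i (Set.inclusion h x)) ∧
      P.belief i = P'.belief i := by
    intro i
    have h1 : ∃ x, P'.normValue i (Set.inclusion h x) = 1 := by
      obtain ⟨a, ha⟩ := P'.exists_normValue_eq_one i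
      obtain ⟨xp, -, hxp, -⟩ := hP.bounds a i
      rw [pref_iff_normUtil, normUtil_constAct, ha] at hxp
      refine ⟨xp, le_antisymm (P'.normValue_mem_Icc i _).2 ?_⟩
      simpa [Profile.normUtil, seu_embAct] using hxp
    have h0 : ∃ x, P'.normValue i (Set.inclusion h x) = 0 := by
      obtain ⟨b, hb⟩ := P'.exists_normValue_eq_zero i
      obtain ⟨-, xm, -, hxm⟩ := hP.bounds b i
      rw [pref_iff_normUtil, normUtil_constAct, hb] at hxm
      refine ⟨xm, le_antisymm ?_ (P'.normValue_mem_Icc i _).1⟩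
      simpa [Profile.normUtil, seu_embAct] using hxm
    refine P.eq_normValue_belief i ⟨?_, ⟨1, fun x => abs_le.2 ⟨?_, ?_⟩⟩,
      (P'.isSEURep i).belief, fun f g => ?_⟩ (fun x => P'.normValue_mem_Icc i _) h1 h0
    · obtain ⟨x, hx⟩ := h1
      obtain ⟨y, hy⟩ := h0
      exact ⟨x, y, by simp [hx, hy]⟩
    · linarith [(P'.normValue_mem_Icc i (Set.inclusion h x)).1]
    · exact (P'.normValue_mem_Icc i _).2
    · rw [← hP.coincide, pref_iff_normUtil]
      rfl
  exact ⟨funext fun i => (key i).2.symm, fun i x => (congrFun (key i).1 x).symm⟩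

end Profile

end SEU

/-! ### Welfarism: only normalized utility vectors matter. -/

section Welfarism

variable {Ω : Type*} [MeasurableSpace Ω] {𝕏 : Type*} {n : ℕ} {X : Menu 𝕏}

/-- The menu consisting of the terms of a finite list of distinct outcomes. -/
def Menu.ofEmbedding {k : ℕ} (e : Fin (k + 2) ↪ 𝕏) : Menu 𝕏 where
  carrier := Set.range e
  countable := Set.countable_range e
  nontrivial := ⟨e 0, ⟨0, rfl⟩, e 1, ⟨1, rfl⟩, e.injective.ne (by simp)⟩

/-- The numbering of the outcomes of a menu given by a list. -/
noncomputable def Menu.enum {k : ℕ} (e : Fin (k + 2) ↪ 𝕏) :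
    Fin (k + 2) ≃ (Menu.ofEmbedding e).Outcome :=
  Equiv.ofInjective e e.injective

/-- The list of vectors is admissible as a table of normalized values. -/
structure IsTable {k : ℕ} (v : Fin (k + 2) → Fin n → ℝ) : Prop where
  mem_Icc : ∀ j i, v j i ∈ Set.Icc (0 : ℝ) 1
  exists_one : ∀ i, ∃ j, v j i = 1
  exists_zero : ∀ i, ∃ j, v j i = 0

/-- The profile on a finite menu with a given table of normalized values. -/
noncomputable def Profile.ofTable {k : ℕ} (e : Fin (k + 2) ↪ 𝕏) {v : Fin (k + 2) → Fin n → ℝ}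
    (hv : IsTable v) {p : Fin n → Measure Ω} (hp : ∀ i, IsBelief (p i)) :
    Profile Ω n (Menu.ofEmbedding e) :=
  Profile.ofValues (fun i x => v ((Menu.enum e).symm x) i) p (fun i _ => hv.mem_Icc _ i)
    (fun i => (hv.exists_one i).imp' (Menu.enum e) fun j hj => by simpa using hj)
    (fun i => (hv.exists_zero i).imp' (Menu.enum e) fun j hj => by simpa using hj) hp

@[simp]
theorem Profile.belief_ofTable {k : ℕ} (e : Fin (k + 2) ↪ 𝕏) {v : Fin (k + 2) → Fin n → ℝ}
    (hv : IsTable v) {p : Fin n → Measure Ω} (hp : ∀ i, IsBelief (p i)) :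
    (Profile.ofTable e hv hp).belief = p := by
  simp [Profile.ofTable]

theorem Profile.normValue_ofTable {k : ℕ} (e : Fin (k + 2) ↪ 𝕏) {v : Fin (k + 2) → Fin n → ℝ}
    (hv : IsTable v) {p : Fin n → Measure Ω} (hp : ∀ i, IsBelief (p i)) :
    (Profile.ofTable e hv hp).normValue = fun i x => v ((Menu.enum e).symm x) i := by
  simp [Profile.ofTable]

@[simp]
theorem Profile.normValue_ofTable_enum {k : ℕ} (e : Fin (k + 2) ↪ 𝕏)
    {v : Fin (k + 2) → Fin n → ℝ} (hv : IsTable v) {p : Fin n → Measure Ω}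
    (hp : ∀ i, IsBelief (p i)) (i : Fin n) (j : Fin (k + 2)) :
    (Profile.ofTable e hv hp).normValue i (Menu.enum e j) = v j i := by
  simp [Profile.normValue_ofTable]

/-- The two constant rows anchor the normalization, leaving the first two rows arbitrary in the
cube. -/
theorem isTable_four {v w : Fin n → ℝ} (hv : ∀ i, v i ∈ Set.Icc (0 : ℝ) 1)
    (hw : ∀ i, w i ∈ Set.Icc (0 : ℝ) 1) :
    IsTable (k := 2) ![v, w, fun _ => 1, fun _ => 0] where
  mem_Icc j i := by fin_cases j <;> simp [Set.mem_Icc.1 (hv i), Set.mem_Icc.1 (hw i)]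
  exists_one i := ⟨2, rfl⟩
  exists_zero i := ⟨3, rfl⟩

theorem isTable_two : IsTable (n := n) (k := 0) ![fun _ => 1, fun _ => 0] where
  mem_Icc j i := by fin_cases j <;> simp
  exists_one i := ⟨0, rfl⟩
  exists_zero i := ⟨1, rfl⟩

theorem exists_embedding_disjoint [Infinite 𝕏] {S : Set 𝕏} (hS : S.Finite) (k : ℕ) :
    ∃ e : Fin k ↪ 𝕏, Disjoint (Set.range e) S := by
  have hinf : Set.Infinite Sᶜ := hS.infinite_compl
  let e : Fin k ↪ 𝕏 :=
    Fin.valEmbedding.trans ((hinf.natEmbedding Sᶜ).trans (Function.Embedding.subtype _))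
  refine ⟨e, Set.disjoint_left.2 ?_⟩
  rintro _ ⟨j, rfl⟩
  exact (hinf.natEmbedding Sᶜ j).2

namespace AggregationRule

variable {R : AggregationRule Ω 𝕏 n}

theorem IIE.rel_iff (hR : R.IIE) {X' : Menu 𝕏} {P' : Profile Ω n X'} {P : Profile Ω n X}
    {h : X.carrier ⊆ X'.carrier} (hP : P'.Extends P h) (f g : Act Ω X) :
    R.rel P' (embAct h f) (embAct h g) ↔ R.rel P f g :=
  hR _ _ P P' h hP.inessentialExpansion f g

theorem Pareto.rel_of_le (hR : R.Pareto) (P : Profile Ω n X) {f g : Act Ω X}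
    (h : P.normUtil g ≤ P.normUtil f) : R.rel P f g :=
  (hR X P f g).1 fun i => (P.pref_iff_normUtil i f g).2 (h i)

theorem Pareto.rel_congr (hR : R.Pareto) (P : Profile Ω n X) {f g f' g' : Act Ω X}
    (hf : P.normUtil f = P.normUtil f') (hg : P.normUtil g = P.normUtil g') :
    R.rel P f g ↔ R.rel P f' g' :=
  ⟨fun h => R.transitive P _ _ _ (hR.rel_of_le P hf.le)
      (R.transitive P _ _ _ h (hR.rel_of_le P hg.ge)),
    fun h => R.transitive P _ _ _ (hR.rel_of_le P hf.ge)
      (R.transitive P _ _ _ h (hR.rel_of_le P hg.le))⟩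

open scoped Classical in
-- The problem is shrunk to a finite menu `S` and then glued to a disjoint problem with the same
-- beliefs. Both are inessentially expanded by the union, where Pareto indifference exchanges the
-- acts. Finiteness of `S` leaves room for disjoint menus.
theorem exists_finite_rel_iff (hPar : R.Pareto) (hIIE : R.IIE) [NeZero n] (P : Profile Ω n X)
    (f g : Act Ω X) :
    ∃ S : Set 𝕏, S.Finite ∧ ∀ (Y : Menu 𝕏) (Q : Profile Ω n Y), Disjoint Y.carrier S →
      Q.belief = P.belief → ∀ f' g' : Act Ω Y, Q.normUtil f' = P.normUtil f →
        Q.normUtil g' = P.normUtil g → (R.rel P f g ↔ R.rel Q f' g') := by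
  choose a ha using P.exists_normValue_eq_one
  choose b hb using P.exists_normValue_eq_zero
  -- Besides the values of both acts, one best and one worst outcome per individual are kept, so
  -- that the restricted values stay normalized.
  let T : Set X.Outcome := Set.range f ∪ Set.range g ∪ Set.range a ∪ Set.range b
  have hT : T.Finite := ((f.finite_range.union g.finite_range).union
    (Set.finite_range a)).union (Set.finite_range b)
  let S : Set 𝕏 := Subtype.val '' T
  have hSfin : S.Finite := hT.image _
  have hfS : ∀ ω, (f ω : 𝕏) ∈ S := fun ω => ⟨_, Or.inl (Or.inl (Or.inl ⟨ω, rfl⟩)), rfl⟩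
  have hgS : ∀ ω, (g ω : 𝕏) ∈ S := fun ω => ⟨_, Or.inl (Or.inl (Or.inr ⟨ω, rfl⟩)), rfl⟩
  have haS : ∀ i, (a i : 𝕏) ∈ S := fun i => ⟨_, Or.inl (Or.inr ⟨i, rfl⟩), rfl⟩
  have hbS : ∀ i, (b i : 𝕏) ∈ S := fun i => ⟨_, Or.inr ⟨i, rfl⟩, rfl⟩
  have hSX : S ⊆ X.carrier := by rintro _ ⟨x, -, rfl⟩; exact x.2
  let X₀ : Menu 𝕏 := ⟨S, hSfin.countable, ⟨_, haS 0, _, hbS 0, fun h => by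
    have h1 := ha 0
    rw [Subtype.ext h, hb] at h1
    exact zero_ne_one h1⟩⟩
  let P₀ : Profile Ω n X₀ := Profile.ofValues (fun i x => P.normValue i (Set.inclusion hSX x))
    P.belief (fun i x => P.normValue_mem_Icc i _) (fun i => ⟨⟨a i, haS i⟩, ha i⟩)
    (fun i => ⟨⟨b i, hbS i⟩, hb i⟩) (fun i => (P.isSEURep i).belief)
  have hP₀b : P₀.belief = P.belief := Profile.belief_ofValues _ _ _ _
  have hP₀v : P₀.normValue = fun i x => P.normValue i (Set.inclusion hSX x) :=
    Profile.normValue_ofValues _ _ _ _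
  have hPP₀ : P.Extends P₀ (h := hSX) := ⟨hP₀b.symm, fun i x => by rw [hP₀v]⟩
  let r : X.Outcome → X₀.Outcome := fun x => if hx : (x : 𝕏) ∈ S then ⟨x, hx⟩ else ⟨a 0, haS 0⟩
  have hr : ∀ x : X.Outcome, (x : 𝕏) ∈ S → Set.inclusion hSX (r x) = x := fun x hx => by
    simp [r, hx, Set.inclusion]
  have hf₀ : embAct (X := X₀) hSX (f.map r) = f := SimpleFunc.ext fun ω => hr _ (hfS ω)
  have hg₀ : embAct (X := X₀) hSX (g.map r) = g := SimpleFunc.ext fun ω => hr _ (hgS ω)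
  refine ⟨S, hSfin, fun Y Q hdis hb' f' g' hf' hg' => ?_⟩
  let Z : Menu 𝕏 := ⟨S ∪ Y.carrier, hSfin.countable.union Y.countable,
    Y.nontrivial.mono Set.subset_union_right⟩
  let u : Fin n → Z.Outcome → ℝ := fun i z =>
    if hz : (z : 𝕏) ∈ S then P.normValue i ⟨z, hSX hz⟩ else Q.normValue i ⟨z, z.2.resolve_left hz⟩
  have hSZ : X₀.carrier ⊆ Z.carrier := Set.subset_union_left
  have hYZ : Y.carrier ⊆ Z.carrier := Set.subset_union_right
  have huS : ∀ i (x : X₀.Outcome), u i (Set.inclusion hSZ x) = P₀.normValue i x := fun i x => by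
    have hx : (x : 𝕏) ∈ S := x.2
    simp [u, hP₀v, hx, Set.inclusion]
  have huY : ∀ i (y : Y.Outcome), u i (Set.inclusion hYZ y) = Q.normValue i y := fun i y => by
    have hy : (y : 𝕏) ∉ S := Set.disjoint_left.1 hdis y.2
    simp [u, hy, Set.inclusion]
  have hu : ∀ i z, u i z ∈ Set.Icc (0 : ℝ) 1 := fun i z => by
    by_cases hz : (z : 𝕏) ∈ S
    · simpa only [u, hz, dite_true] using P.normValue_mem_Icc i _
    · simpa only [u, hz, dite_false] using Q.normValue_mem_Icc i _
  let PZ : Profile Ω n Z := Profile.ofValues u P.belief hu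
    (fun i => (Q.exists_normValue_eq_one i).imp' (Set.inclusion hYZ) fun y hy => by
      rw [huY, hy])
    (fun i => (Q.exists_normValue_eq_zero i).imp' (Set.inclusion hYZ) fun y hy => by
      rw [huY, hy]) (fun i => (P.isSEURep i).belief)
  have hPZb : PZ.belief = P.belief := Profile.belief_ofValues _ _ _ _
  have hPZv : PZ.normValue = u := Profile.normValue_ofValues _ _ _ _
  have hZ₀ : PZ.Extends P₀ hSZ := ⟨hPZb.trans hP₀b.symm, fun i x => by rw [hPZv, huS]⟩
  have hZQ : PZ.Extends Q hYZ := ⟨hPZb.trans hb'.symm, fun i x => by rw [hPZv, huY]⟩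
  have hUf : P₀.normUtil (f.map r) = P.normUtil f := by rw [← hPP₀.normUtil, hf₀]
  have hUg : P₀.normUtil (g.map r) = P.normUtil g := by rw [← hPP₀.normUtil, hg₀]
  calc R.rel P f g ↔ R.rel P (embAct (X := X₀) hSX (f.map r)) (embAct (X := X₀) hSX (g.map r)) := by
        rw [hf₀, hg₀]
    _ ↔ R.rel P₀ (f.map r) (g.map r) := hIIE.rel_iff hPP₀ _ _
    _ ↔ R.rel PZ (embAct hSZ (f.map r)) (embAct hSZ (g.map r)) := (hIIE.rel_iff hZ₀ _ _).symm
    _ ↔ R.rel PZ (embAct hYZ f') (embAct hYZ g') := hPar.rel_congr PZ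
        (by rw [hZ₀.normUtil, hZQ.normUtil, hUf, hf']) (by rw [hZ₀.normUtil, hZQ.normUtil, hUg, hg'])
    _ ↔ R.rel Q f' g' := hIIE.rel_iff hZQ _ _

/-- Welfarism: the social preference between two acts depends only on their vectors of normalized
expected utilities. -/
theorem rel_iff_of_normUtil_eq [Infinite 𝕏] [NeZero n] (hPar : R.Pareto) (hIIE : R.IIE)
    (hBel : R.BeliefIrrelevance) {X X' : Menu 𝕏} (P : Profile Ω n X) (P' : Profile Ω n X')
    {f g : Act Ω X} {f' g' : Act Ω X'} (hf : P.normUtil f = P'.normUtil f')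
    (hg : P.normUtil g = P'.normUtil g') : R.rel P f g ↔ R.rel P' f' g' := by
  obtain ⟨S, hS, h⟩ := exists_finite_rel_iff hPar hIIE P f g
  obtain ⟨S', hS', h'⟩ := exists_finite_rel_iff hPar hIIE P' f' g'
  -- A single fresh menu must serve both problems: two outcomes stand for the acts and two fix the
  -- normalization. On it the problems differ only in beliefs.
  obtain ⟨e, he⟩ := exists_embedding_disjoint (hS.union hS') 4
  rw [Set.disjoint_union_right] at he
  have hT := isTable_four (P.normUtil_mem_Icc f) (P.normUtil_mem_Icc g)
  let Q := Profile.ofTable e hT fun i => (P.isSEURep i).belief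
  let Q' := Profile.ofTable e hT fun i => (P'.isSEURep i).belief
  have hQ : ∀ j, Q.normUtil (constAct Ω (Menu.enum e j)) =
      ![P.normUtil f, P.normUtil g, fun _ => 1, fun _ => 0] j := fun j => funext fun i => by
    rw [Profile.normUtil_constAct, Profile.normValue_ofTable_enum]
  have hQ' : ∀ j, Q'.normUtil (constAct Ω (Menu.enum e j)) =
      ![P.normUtil f, P.normUtil g, fun _ => 1, fun _ => 0] j := fun j => funext fun i => by
    rw [Profile.normUtil_constAct, Profile.normValue_ofTable_enum]
  rw [h _ Q he.1 (Profile.belief_ofTable _ _ _) (constAct Ω (Menu.enum e 0))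
      (constAct Ω (Menu.enum e 1)) (hQ 0) (hQ 1),
    h' _ Q' he.2 (Profile.belief_ofTable _ _ _) (constAct Ω (Menu.enum e 0))
      (constAct Ω (Menu.enum e 1)) ((hQ' 0).trans hf) ((hQ' 1).trans hg)]
  exact hBel _ Q Q' (by rw [Profile.normValue_ofTable, Profile.normValue_ofTable]) _ _

end AggregationRule

end Welfarism

/-! ### Concavity, supporting weights and the conjugate penalty on the cube. -/

section Variational

/-- A continuous function on `[0, 1]` that is midpoint concave at small scales lies above its
chord. -/
theorem chord_le_of_local_midpoint {g : ℝ → ℝ} (hg : ContinuousOn g (Set.Icc 0 1)) {δ : ℝ}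
    (hδ : 0 < δ) (hloc : ∀ s ∈ Set.Icc (0 : ℝ) 1, ∀ t ∈ Set.Icc (0 : ℝ) 1, |s - t| ≤ δ →
      (g s + g t) / 2 ≤ g ((s + t) / 2)) {t : ℝ} (ht : t ∈ Set.Icc (0 : ℝ) 1) :
    (1 - t) * g 0 + t * g 1 ≤ g t := by
  by_contra! hlt
  let k : ℝ → ℝ := fun s => g s - ((1 - s) * g 0 + s * g 1)
  have hk : ContinuousOn k (Set.Icc 0 1) := hg.sub (by fun_prop)
  obtain ⟨s, hs, hmin⟩ := isCompact_Icc.exists_isMinOn ⟨t, ht⟩ hk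
  -- The leftmost minimizer `a` of the gap `k` is taken: points to its left are strictly above the
  -- minimum, so a small symmetric step around `a` violates the midpoint inequality.
  have hM : IsCompact (Set.Icc (0 : ℝ) 1 ∩ k ⁻¹' Set.Iic (k s)) :=
    isCompact_Icc.of_isClosed_subset (hk.preimage_isClosed_of_isClosed isClosed_Icc isClosed_Iic)
      Set.inter_subset_left
  obtain ⟨a, ⟨ha, hka⟩, hleast⟩ := hM.exists_isLeast ⟨s, hs, le_refl (k s)⟩
  have hkneg : k a < 0 := lt_of_le_of_lt (le_trans hka (hmin ht)) (by simp only [k]; linarith)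
  have ha0 : 0 < a := lt_of_le_of_ne ha.1 fun h => by simp [k, ← h] at hkneg
  have ha1 : a < 1 := lt_of_le_of_ne ha.2 fun h => by simp [k, h] at hkneg
  obtain ⟨h, h0, hha, hha', hhδ⟩ : ∃ h, 0 < h ∧ h ≤ a ∧ h ≤ 1 - a ∧ 2 * h ≤ δ :=
    ⟨min a (min (1 - a) (δ / 2)), lt_min ha0 (lt_min (by linarith) (by linarith)),
      min_le_left _ _, (min_le_right _ _).trans (min_le_left _ _), by
        linarith [(min_le_right a (min (1 - a) (δ / 2))).trans (min_le_right _ _)]⟩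
  have hl : a - h ∈ Set.Icc (0 : ℝ) 1 := ⟨by linarith, by linarith⟩
  have hr : a + h ∈ Set.Icc (0 : ℝ) 1 := ⟨by linarith, by linarith⟩
  have h1 : k s < k (a - h) := by
    by_contra! hle
    have := hleast ⟨hl, hle⟩
    linarith
  have h2 : k s ≤ k (a + h) := hmin hr
  have h3 := hloc _ hl _ hr (by rw [abs_le]; constructor <;> linarith)
  rw [show (a - h + (a + h)) / 2 = a by ring] at h3
  have h4 : k a ≤ k s := hka
  simp only [k] at h1 h2 h4
  nlinarith

variable {n : ℕ}

/-- Monotone, translation invariant, midpoint quasiconcave, normalized on constants: properties of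
the equally-distributed equivalent on the unit cube of utility vectors. -/
structure IsCubeWelfare (W : (Fin n → ℝ) → ℝ) : Prop where
  const : ∀ c ∈ Set.Icc (0 : ℝ) 1, W (fun _ => c) = c
  mono : ∀ v ∈ Set.Icc (0 : Fin n → ℝ) 1, ∀ w ∈ Set.Icc (0 : Fin n → ℝ) 1, v ≤ w → W v ≤ W w
  translate : ∀ v ∈ Set.Icc (0 : Fin n → ℝ) 1, ∀ c : ℝ,
    (fun i => v i + c) ∈ Set.Icc (0 : Fin n → ℝ) 1 → W (fun i => v i + c) = W v + c
  midpoint : ∀ v ∈ Set.Icc (0 : Fin n → ℝ) 1, ∀ w ∈ Set.Icc (0 : Fin n → ℝ) 1,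
    min (W v) (W w) ≤ W (fun i => (v i + w i) / 2)

namespace IsCubeWelfare

variable {W : (Fin n → ℝ) → ℝ}

theorem mem_Icc (hW : IsCubeWelfare W) {v : Fin n → ℝ} (hv : v ∈ Set.Icc (0 : Fin n → ℝ) 1) :
    W v ∈ Set.Icc (0 : ℝ) 1 := by
  constructor
  · rw [← hW.const 0 (by simp)]
    exact hW.mono _ (by simp [Pi.le_def]) _ hv hv.1
  · rw [← hW.const 1 (by simp)]
    exact hW.mono _ hv _ (by simp [Pi.le_def]) hv.2

/-- Monotonicity and translation combined, even when `w + c` leaves the cube. For `c ≥ 0` it is `v`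
that is lowered; for `-1 ≤ c < 0`, first raising `w` to `max w (-c)` keeps its translate in the cube
and below `v`; for `c < -1` the range of `W` suffices. -/
theorem add_le (hW : IsCubeWelfare W) {v w : Fin n → ℝ} (hv : v ∈ Set.Icc (0 : Fin n → ℝ) 1)
    (hw : w ∈ Set.Icc (0 : Fin n → ℝ) 1) {c : ℝ} (h : ∀ i, w i + c ≤ v i) : W w + c ≤ W v := by
  have hv0 : ∀ i, 0 ≤ v i := hv.1
  have hv1 : ∀ i, v i ≤ 1 := hv.2
  have hw0 : ∀ i, 0 ≤ w i := hw.1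
  have hw1 : ∀ i, w i ≤ 1 := hw.2
  rcases le_or_gt 0 c with hc | hc
  · have hmem : (fun i => v i + -c) ∈ Set.Icc (0 : Fin n → ℝ) 1 :=
      ⟨fun i => by have := h i; have := hw0 i; simp; linarith,
        fun i => by have := hv1 i; simp; linarith⟩
    have h1 := hW.translate v hv (-c) hmem
    have h2 := hW.mono w hw _ hmem fun i => by have := h i; simp; linarith
    linarith
  rcases le_or_gt (-c) 1 with hc1 | hc1
  · have hmem : (fun i => max (w i) (-c)) ∈ Set.Icc (0 : Fin n → ℝ) 1 :=
      ⟨fun i => le_max_of_le_left (hw0 i), fun i => max_le (hw1 i) hc1⟩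
    have hmem' : (fun i => max (w i) (-c) + c) ∈ Set.Icc (0 : Fin n → ℝ) 1 :=
      ⟨fun i => by have := le_max_right (w i) (-c); simp; linarith,
        fun i => by have := max_le (hw1 i) hc1; simp; linarith⟩
    have h1 := hW.translate _ hmem c hmem'
    have h2 := hW.mono w hw _ hmem fun i => le_max_left _ _
    have h3 := hW.mono _ hmem' v hv fun i => by
      simp only
      have := h i
      have := hv0 i
      rcases max_choice (w i) (-c) with e | e <;> rw [e] <;> linarith
    linarith
  · have := (hW.mem_Icc hw).2
    have := (hW.mem_Icc hv).1
    linarith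

theorem abs_sub_le (hW : IsCubeWelfare W) {v w : Fin n → ℝ} (hv : v ∈ Set.Icc (0 : Fin n → ℝ) 1)
    (hw : w ∈ Set.Icc (0 : Fin n → ℝ) 1) {ε : ℝ} (h : ∀ i, |v i - w i| ≤ ε) :
    |W v - W w| ≤ ε := by
  have h1 := hW.add_le hv hw (c := -ε) fun i => by linarith [(abs_le.1 (h i)).1]
  have h2 := hW.add_le hw hv (c := -ε) fun i => by linarith [(abs_le.1 (h i)).2]
  rw [abs_le]
  constructor <;> linarith

/-- Shifting `w` by `W v - W w` gives two vectors of equal welfare, for which quasiconcavity bounds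
the midpoint by that common level; undoing half the shift gives concavity. The margin `δ` keeps the
shifted vector in the cube. -/
theorem midpoint_concave (hW : IsCubeWelfare W) {v w : Fin n → ℝ} {δ : ℝ} (hδ : 0 ≤ δ)
    (hv : ∀ i, v i ∈ Set.Icc δ (1 - δ)) (hw : ∀ i, w i ∈ Set.Icc δ (1 - δ))
    (h : |W v - W w| ≤ δ) : (W v + W w) / 2 ≤ W (fun i => (v i + w i) / 2) := by
  have hv' : v ∈ Set.Icc (0 : Fin n → ℝ) 1 :=
    ⟨fun i => by simpa using hδ.trans (hv i).1, fun i => by have := (hv i).2; simp; linarith⟩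
  have hw' : w ∈ Set.Icc (0 : Fin n → ℝ) 1 :=
    ⟨fun i => by simpa using hδ.trans (hw i).1, fun i => by have := (hw i).2; simp; linarith⟩
  obtain ⟨hl, hr⟩ := abs_le.1 h
  have hwc : (fun i => w i + (W v - W w)) ∈ Set.Icc (0 : Fin n → ℝ) 1 :=
    ⟨fun i => by have := (hw i).1; simp; linarith, fun i => by have := (hw i).2; simp; linarith⟩
  have hm : (fun i => (v i + w i) / 2) ∈ Set.Icc (0 : Fin n → ℝ) 1 :=
    ⟨fun i => by have := (hw i).1; have := (hv i).1; simp; linarith,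
      fun i => by have := (hw i).2; have := (hv i).2; simp; linarith⟩
  have e : (fun i => (v i + (w i + (W v - W w))) / 2) =
      fun i => (v i + w i) / 2 + (W v - W w) / 2 := funext fun i => by ring
  have hm' : (fun i => (v i + w i) / 2 + (W v - W w) / 2) ∈ Set.Icc (0 : Fin n → ℝ) 1 :=
    ⟨fun i => by have := (hw i).1; have := (hv i).1; simp; linarith,
      fun i => by have := (hw i).2; have := (hv i).2; simp; linarith⟩
  have h1 := hW.midpoint v hv' _ hwc
  rw [e, hW.translate _ hw' _ hwc, hW.translate _ hm _ hm', add_sub_cancel, min_self] at h1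
  linarith

/-- Along a segment `W` is 1-Lipschitz in the parameter, so parameters within `δ` have welfare
within `δ`. Midpoint concavity thus holds at scale `δ`, and `chord_le_of_local_midpoint` makes it
global. -/
theorem concave_inner (hW : IsCubeWelfare W) {v w : Fin n → ℝ} {δ : ℝ} (hδ : 0 < δ)
    (hv : ∀ i, v i ∈ Set.Icc δ (1 - δ)) (hw : ∀ i, w i ∈ Set.Icc δ (1 - δ)) {t : ℝ}
    (ht : t ∈ Set.Icc (0 : ℝ) 1) :
    (1 - t) * W v + t * W w ≤ W (fun i => v i + t * (w i - v i)) := by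
  have hseg : ∀ s ∈ Set.Icc (0 : ℝ) 1, ∀ i, v i + s * (w i - v i) ∈ Set.Icc δ (1 - δ) := by
    intro s hs i
    have h1 := mul_le_mul_of_nonneg_left (hv i).1 (sub_nonneg.2 hs.2)
    have h2 := mul_le_mul_of_nonneg_left (hw i).1 hs.1
    have h3 := mul_le_mul_of_nonneg_left (hv i).2 (sub_nonneg.2 hs.2)
    have h4 := mul_le_mul_of_nonneg_left (hw i).2 hs.1
    constructor <;> linarith
  have hcube : ∀ s ∈ Set.Icc (0 : ℝ) 1, (fun i => v i + s * (w i - v i)) ∈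
      Set.Icc (0 : Fin n → ℝ) 1 := fun s hs =>
    ⟨fun i => by have := (hseg s hs i).1; simp; linarith,
      fun i => by have := (hseg s hs i).2; simp; linarith⟩
  have hlip : ∀ s ∈ Set.Icc (0 : ℝ) 1, ∀ s' ∈ Set.Icc (0 : ℝ) 1,
      |W (fun i => v i + s * (w i - v i)) - W (fun i => v i + s' * (w i - v i))| ≤ |s - s'| := by
    intro s hs s' hs'
    refine hW.abs_sub_le (hcube s hs) (hcube s' hs') fun i => ?_
    rw [add_sub_add_left_eq_sub, ← sub_mul, abs_mul]
    refine mul_le_of_le_one_right (abs_nonneg _) (abs_le.2 ⟨?_, ?_⟩) <;>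
      linarith [(hv i).1, (hv i).2, (hw i).1, (hw i).2]
  have hcont : ContinuousOn (fun s => W (fun i => v i + s * (w i - v i))) (Set.Icc 0 1) := by
    refine LipschitzOnWith.continuousOn (K := 1) (LipschitzOnWith.of_dist_le_mul ?_)
    intro s hs s' hs'
    simpa [Real.dist_eq] using hlip s hs s' hs'
  have h := chord_le_of_local_midpoint hcont hδ (fun s hs s' hs' hss => ?_) ht
  · simpa using h
  · have := hW.midpoint_concave hδ.le (hseg s hs) (hseg s' hs') ((hlip s hs s' hs').trans hss)
    convert this using 3
    ring

theorem concave (hW : IsCubeWelfare W) {v w : Fin n → ℝ} (hv : v ∈ Set.Icc (0 : Fin n → ℝ) 1)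
    (hw : w ∈ Set.Icc (0 : Fin n → ℝ) 1) {t : ℝ} (ht : t ∈ Set.Icc (0 : ℝ) 1) :
    (1 - t) * W v + t * W w ≤ W (fun i => v i + t * (w i - v i)) := by
  have hv0 : ∀ i, 0 ≤ v i := hv.1
  have hv1 : ∀ i, v i ≤ 1 := hv.2
  have hw0 : ∀ i, 0 ≤ w i := hw.1
  have hw1 : ∀ i, w i ≤ 1 := hw.2
  have hz : ∀ i, v i + t * (w i - v i) ∈ Set.Icc (0 : ℝ) 1 := by
    intro i
    have h1 := mul_nonneg (sub_nonneg.2 ht.2) (hv0 i)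
    have h2 := mul_nonneg ht.1 (hw0 i)
    have h3 := mul_le_mul_of_nonneg_left (hv1 i) (sub_nonneg.2 ht.2)
    have h4 := mul_le_mul_of_nonneg_left (hw1 i) ht.1
    constructor <;> linarith
  -- The map `x ↦ (1 - 2 * δ) * x + δ` contracts the cube into the inner one and moves coordinates
  -- by at most `δ`. The inner inequality therefore passes to the cube with error at most `2 * δ ≤
  -- ε`.
  refine le_of_forall_pos_le_add fun ε hε => ?_
  obtain ⟨δ, hδ, hδ1, hδε⟩ : ∃ δ : ℝ, 0 < δ ∧ 2 * δ ≤ 1 ∧ 2 * δ ≤ ε :=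
    ⟨min (1 / 2) (ε / 2), by positivity, by linarith [min_le_left (1 / 2) (ε / 2)],
      by linarith [min_le_right (1 / 2) (ε / 2)]⟩
  have hin : ∀ x ∈ Set.Icc (0 : ℝ) 1, (1 - 2 * δ) * x + δ ∈ Set.Icc δ (1 - δ) := fun x hx => by
    have h1 := mul_nonneg (by linarith : 0 ≤ 1 - 2 * δ) hx.1
    have h2 := mul_le_mul_of_nonneg_left hx.2 (by linarith : 0 ≤ 1 - 2 * δ)
    constructor <;> linarith
  have hcube : ∀ x : Fin n → ℝ, (∀ i, x i ∈ Set.Icc (0 : ℝ) 1) →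
      (fun i => (1 - 2 * δ) * x i + δ) ∈ Set.Icc (0 : Fin n → ℝ) 1 := fun x hx =>
    ⟨fun i => by have := (hin _ (hx i)).1; simp; linarith,
      fun i => by have := (hin _ (hx i)).2; simp; linarith⟩
  have hclose : ∀ x : Fin n → ℝ, (∀ i, x i ∈ Set.Icc (0 : ℝ) 1) →
      |W (fun i => (1 - 2 * δ) * x i + δ) - W x| ≤ δ := fun x hx => by
    refine hW.abs_sub_le (hcube x hx) ⟨fun i => (hx i).1, fun i => (hx i).2⟩ fun i => ?_
    have h1 := mul_nonneg hδ.le (hx i).1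
    have h2 := mul_le_mul_of_nonneg_left (hx i).2 hδ.le
    rw [abs_le]
    constructor <;> linarith
  have hc := hW.concave_inner hδ (fun i => hin _ ⟨hv0 i, hv1 i⟩) (fun i => hin _ ⟨hw0 i, hw1 i⟩) ht
  rw [show (fun i => (1 - 2 * δ) * v i + δ +
      t * ((1 - 2 * δ) * w i + δ - ((1 - 2 * δ) * v i + δ))) =
      fun i => (1 - 2 * δ) * (v i + t * (w i - v i)) + δ from funext fun i => by ring] at hc
  have h1 := abs_le.1 (hclose v fun i => ⟨hv0 i, hv1 i⟩)
  have h2 := abs_le.1 (hclose w fun i => ⟨hw0 i, hw1 i⟩)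
  have h3 := abs_le.1 (hclose _ hz)
  have h4 := mul_le_mul_of_nonneg_left h1.1 (sub_nonneg.2 ht.2)
  have h5 := mul_le_mul_of_nonneg_left h2.1 ht.1
  linarith [h3.2]

/-- Supporting weights: `W` has a supergradient in the simplex at every point of the cube. -/
theorem exists_supergradient (hW : IsCubeWelfare W) {v : Fin n → ℝ}
    (hv : v ∈ Set.Icc (0 : Fin n → ℝ) 1) :
    ∃ μ ∈ stdSimplex ℝ (Fin n), ∀ w ∈ Set.Icc (0 : Fin n → ℝ) 1,
      W w - ∑ i, μ i * w i ≤ W v - ∑ i, μ i * v i := by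
  -- The vectors strictly above some `w - W w`: an open set, convex because `W` is concave.
  -- Subtracting `W w` moves every `w` to welfare level zero, so one hyperplane at `v - W v`
  -- compares all of them.
  let S : Set (Fin n → ℝ) :=
    ⋃ w ∈ Set.Icc (0 : Fin n → ℝ) 1, Set.univ.pi fun i => Set.Ioi (w i - W w)
  have hmem : ∀ x, x ∈ S ↔ ∃ w ∈ Set.Icc (0 : Fin n → ℝ) 1, ∀ i, w i - W w < x i := fun x => by
    simp only [S, Set.mem_iUnion, exists_prop, Set.mem_univ_pi, Set.mem_Ioi]
  have hopen : IsOpen S := isOpen_biUnion fun w _ =>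
    isOpen_set_pi Set.finite_univ fun i _ => isOpen_Ioi
  have hconv : Convex ℝ S := by
    intro x hx y hy a b ha hb hab
    obtain ⟨w, hw, hwx⟩ := (hmem x).1 hx
    obtain ⟨z, hz, hzy⟩ := (hmem y).1 hy
    obtain rfl : a = 1 - b := by linarith
    have hc := hW.concave hw hz (t := b) ⟨hb, by linarith⟩
    have hcube := (convex_Icc (0 : Fin n → ℝ) 1) hw hz ha hb hab
    have e : ((1 - b) • w + b • z) = fun i => w i + b * (z i - w i) := by
      funext i; simp; ring
    rw [e] at hcube
    refine (hmem _).2 ⟨_, hcube, fun i => ?_⟩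
    simp only [Pi.add_apply, Pi.smul_apply, smul_eq_mul]
    have hlt : (1 - b) * (w i - W w) + b * (z i - W z) < (1 - b) * x i + b * y i := by
      rcases hb.eq_or_lt with rfl | hb0
      · simpa using hwx i
      · exact add_lt_add_of_le_of_lt (mul_le_mul_of_nonneg_left (hwx i).le ha)
          (mul_lt_mul_of_pos_left (hzy i) hb0)
    linarith
  let x₀ : Fin n → ℝ := fun i => v i - W v
  have hx₀ : x₀ ∉ S := by
    intro h
    obtain ⟨w, hw, hlt⟩ := (hmem _).1 h
    obtain ⟨ε, hε, hle⟩ : ∃ ε > 0, ∀ i, w i - W w + ε ≤ x₀ i := by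
      rcases isEmpty_or_nonempty (Fin n) with hem | hne
      · exact ⟨1, one_pos, fun i => hem.elim i⟩
      · obtain ⟨j, hj⟩ := Finite.exists_min fun i => x₀ i - (w i - W w)
        exact ⟨_, sub_pos.2 (hlt j), fun i => by linarith [hj i]⟩
    have := hW.add_le hv hw (c := W v - W w + ε) fun i => by
      have := hle i
      simp only [x₀] at this
      linarith
    linarith
  obtain ⟨f, hf⟩ := geometric_hahn_banach_point_open hconv hopen hx₀
  -- `S` contains every vector strictly above `x₀`, so `f` is positive on strictly positive vectors.
  -- In the limit its coefficients are nonnegative, and their sum is positive, which allows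
  -- normalizing.
  have hup : ∀ c : Fin n → ℝ, (∀ i, 0 < c i) → 0 < f c := by
    intro c hc
    have : x₀ + c ∈ S := (hmem _).2 ⟨v, hv, fun i => by simp [x₀, hc i]⟩
    have := hf _ this
    rw [map_add] at this
    linarith
  let m : Fin n → ℝ := fun i => f (Pi.single i 1)
  have hfm : ∀ x, f x = ∑ i, m i * x i := fun x => by
    have := LinearMap.pi_apply_eq_sum_univ f.toLinearMap x
    simp only [ContinuousLinearMap.coe_coe, smul_eq_mul] at this
    rw [this]
    refine Finset.sum_congr rfl fun i _ => ?_
    rw [mul_comm]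
    congr 2
    funext j
    simp [Pi.single_apply, eq_comm]
  have hm0 : ∀ i, 0 ≤ m i := by
    intro i
    have hlim : Tendsto (fun ε : ℝ => f (Pi.single i 1 + fun _ => ε)) (𝓝[>] 0)
        (𝓝 (f (Pi.single i 1 + fun _ => (0 : ℝ)))) := by
      refine Tendsto.mono_left (Continuous.tendsto ?_ 0) nhdsWithin_le_nhds
      fun_prop
    have e : (Pi.single i 1 + fun _ => (0 : ℝ)) = (Pi.single i 1 : Fin n → ℝ) := by
      funext j; simp
    rw [e] at hlim
    refine ge_of_tendsto hlim ?_
    filter_upwards [self_mem_nhdsWithin] with ε hε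
    refine (hup _ fun j => ?_).le
    have h0 : (0 : ℝ) ≤ (Pi.single i 1 : Fin n → ℝ) j := by
      by_cases hj : j = i
      · subst hj; simp
      · simp [hj]
    exact add_pos_of_nonneg_of_pos h0 hε
  have hs : 0 < ∑ i, m i := by
    have := hup (fun _ => 1) fun _ => one_pos
    rw [hfm] at this
    simpa using this
  refine ⟨fun i => m i / ∑ j, m j, ⟨fun i => div_nonneg (hm0 i) hs.le, ?_⟩, fun w hw => ?_⟩
  · rw [← Finset.sum_div, div_self hs.ne']
  · have hsum : ∀ x : Fin n → ℝ, ∑ i, m i / (∑ j, m j) * x i = f x / ∑ j, m j := fun x => by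
      rw [hfm, Finset.sum_div]
      exact Finset.sum_congr rfl fun i _ => by ring
    have hconst : ∀ c : ℝ, f (fun _ => c) = c * ∑ j, m j := fun c => by
      rw [hfm, Finset.mul_sum]
      exact Finset.sum_congr rfl fun i _ => mul_comm _ _
    -- The vector `w - W w` is only a limit of points of `S`, so the strict separation becomes weak.
    have hle : f x₀ ≤ f (fun i => w i - W w) := by
      have hlim : Tendsto (fun ε : ℝ => f ((fun i => w i - W w) + fun _ => ε)) (𝓝[>] 0)
          (𝓝 (f ((fun i => w i - W w) + fun _ => (0 : ℝ)))) := by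
        refine Tendsto.mono_left (Continuous.tendsto ?_ 0) nhdsWithin_le_nhds
        fun_prop
      have e : ((fun i => w i - W w) + fun _ => (0 : ℝ)) = fun i => w i - W w := by
        funext j; simp
      rw [e] at hlim
      refine ge_of_tendsto hlim ?_
      filter_upwards [self_mem_nhdsWithin] with ε hε
      exact (hf _ ((hmem _).2 ⟨w, hw, fun i => lt_add_of_pos_right _ hε⟩)).le
    have e1 : f x₀ = f v - W v * ∑ j, m j := by
      rw [← hconst, ← map_sub]; rfl
    have e2 : f (fun i => w i - W w) = f w - W w * ∑ j, m j := by
      rw [← hconst, ← map_sub]; rfl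
    rw [e1, e2] at hle
    have h : W w - W v ≤ f w / ∑ j, m j - f v / ∑ j, m j := by
      rw [← sub_div, le_div_iff₀ hs]
      linarith
    rw [hsum, hsum]
    linarith

end IsCubeWelfare

/-- The penalty conjugate to `W`. -/
noncomputable def cubePenalty (W : (Fin n → ℝ) → ℝ) (μ : Fin n → ℝ) : ℝ≥0∞ :=
  ⨆ v ∈ Set.Icc (0 : Fin n → ℝ) 1, ENNReal.ofReal (W v - ∑ i, μ i * v i)

/-- A supremum of positive parts of affine functions of `μ`; subadditivity of `ENNReal.ofReal`
handles the positive part. -/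
theorem convexOn_cubePenalty (W : (Fin n → ℝ) → ℝ) :
    ConvexOn ℝ≥0 (stdSimplex ℝ (Fin n)) (cubePenalty W) := by
  refine ⟨fun x hx y hy a b _ _ hab => convex_stdSimplex ℝ (Fin n) hx hy a.2 b.2
    (by exact_mod_cast hab), fun x _ y _ a b _ _ hab => ?_⟩
  refine iSup₂_le fun v hv => ?_
  have hab' : (a : ℝ) + b = 1 := by exact_mod_cast hab
  have e : W v - ∑ i, (a • x + b • y) i * v i =
      a * (W v - ∑ i, x i * v i) + b * (W v - ∑ i, y i * v i) := by
    have : ∑ i, (a • x + b • y) i * v i = a * ∑ i, x i * v i + b * ∑ i, y i * v i := by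
      rw [Finset.mul_sum, Finset.mul_sum, ← Finset.sum_add_distrib]
      refine Finset.sum_congr rfl fun i _ => ?_
      simp only [Pi.add_apply, Pi.smul_apply, NNReal.smul_def, smul_eq_mul]
      ring
    rw [this]
    linear_combination (-W v) * hab'
  have hterm : ∀ z : Fin n → ℝ, ENNReal.ofReal (W v - ∑ i, z i * v i) ≤ cubePenalty W z :=
    fun z => le_iSup₂ (f := fun v (_ : v ∈ Set.Icc (0 : Fin n → ℝ) 1) =>
      ENNReal.ofReal (W v - ∑ i, z i * v i)) v hv
  rw [e]
  refine ENNReal.ofReal_add_le.trans (add_le_add ?_ ?_)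
  · rw [ENNReal.ofReal_mul NNReal.zero_le_coe, ENNReal.ofReal_coe_nnreal, ENNReal.smul_def, smul_eq_mul]
    gcongr
    exact hterm x
  · rw [ENNReal.ofReal_mul NNReal.zero_le_coe, ENNReal.ofReal_coe_nnreal, ENNReal.smul_def, smul_eq_mul]
    gcongr
    exact hterm y

theorem lowerSemicontinuous_cubePenalty (W : (Fin n → ℝ) → ℝ) :
    LowerSemicontinuous (cubePenalty W) :=
  lowerSemicontinuous_biSup fun v _ => Continuous.lowerSemicontinuous
    (ENNReal.continuous_ofReal.comp (by fun_prop))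

namespace IsCubeWelfare

variable {W : (Fin n → ℝ) → ℝ}

theorem zero_eq (hW : IsCubeWelfare W) : W 0 = 0 := hW.const 0 (by simp)

/-- A supergradient at `v` is a weight for which the supremum defining the penalty is attained at
`v`. Comparison with the zero vector shows the value to be nonnegative, so truncation at zero loses
nothing. -/
theorem exists_cubePenalty_eq (hW : IsCubeWelfare W) {v : Fin n → ℝ}
    (hv : v ∈ Set.Icc (0 : Fin n → ℝ) 1) :
    ∃ μ ∈ stdSimplex ℝ (Fin n), 0 ≤ W v - ∑ i, μ i * v i ∧
      cubePenalty W μ = ENNReal.ofReal (W v - ∑ i, μ i * v i) := by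
  obtain ⟨μ, hμ, h⟩ := hW.exists_supergradient hv
  refine ⟨μ, hμ, ?_, le_antisymm (iSup₂_le fun w hw => ENNReal.ofReal_le_ofReal (h w hw))
    (le_iSup₂ (f := fun v (_ : v ∈ Set.Icc (0 : Fin n → ℝ) 1) =>
      ENNReal.ofReal (W v - ∑ i, μ i * v i)) v hv)⟩
  simpa [hW.zero_eq] using h 0 ⟨le_rfl, fun _ => zero_le_one⟩

theorem grounded_cubePenalty (hW : IsCubeWelfare W) : Grounded (cubePenalty W) := by
  obtain ⟨μ, hμ, -, h⟩ := hW.exists_cubePenalty_eq (v := 0) ⟨le_rfl, fun _ => zero_le_one⟩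
  refine le_antisymm ((iInf₂_le μ hμ).trans ?_) bot_le
  simp [h, hW.zero_eq]

/-- Variational representation of `W` on the cube. -/
theorem isVariationalMin (hW : IsCubeWelfare W) {v : Fin n → ℝ}
    (hv : v ∈ Set.Icc (0 : Fin n → ℝ) 1) : IsVariationalMin (cubePenalty W) v (W v) := by
  constructor
  · obtain ⟨μ, hμ, h0, h⟩ := hW.exists_cubePenalty_eq hv
    refine ⟨μ, hμ, ?_⟩
    simp only
    rw [h, EReal.coe_ennreal_ofReal, max_eq_left h0, ← EReal.coe_add, add_sub_cancel]
  · rintro _ ⟨μ, -, rfl⟩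
    have h : ENNReal.ofReal (W v - ∑ i, μ i * v i) ≤ cubePenalty W μ :=
      le_iSup₂ (f := fun v (_ : v ∈ Set.Icc (0 : Fin n → ℝ) 1) =>
        ENNReal.ofReal (W v - ∑ i, μ i * v i)) v hv
    calc ((W v : ℝ) : EReal)
        = ((∑ i, μ i * v i : ℝ) : EReal) + ((W v - ∑ i, μ i * v i : ℝ) : EReal) := by
          rw [← EReal.coe_add, add_sub_cancel]
      _ ≤ ((∑ i, μ i * v i : ℝ) : EReal) +
          ((ENNReal.ofReal (W v - ∑ i, μ i * v i) : ℝ≥0∞) : EReal) := by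
          refine add_le_add le_rfl ?_
          rw [EReal.coe_ennreal_ofReal]
          exact_mod_cast le_max_left _ _
      _ ≤ _ := by
          refine add_le_add le_rfl ?_
          exact_mod_cast h

end IsCubeWelfare

/-- The properties, on the unit cube of utility vectors, of an ordering with a variational
representation. -/
structure IsCubeOrder (r : (Fin n → ℝ) → (Fin n → ℝ) → Prop) : Prop where
  total : ∀ v ∈ Set.Icc (0 : Fin n → ℝ) 1, ∀ w ∈ Set.Icc (0 : Fin n → ℝ) 1, r v w ∨ r w v
  trans : ∀ v ∈ Set.Icc (0 : Fin n → ℝ) 1, ∀ w ∈ Set.Icc (0 : Fin n → ℝ) 1,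
    ∀ x ∈ Set.Icc (0 : Fin n → ℝ) 1, r v w → r w x → r v x
  mono : ∀ v ∈ Set.Icc (0 : Fin n → ℝ) 1, ∀ w ∈ Set.Icc (0 : Fin n → ℝ) 1, w ≤ v → r v w
  strict : ∀ v ∈ Set.Icc (0 : Fin n → ℝ) 1, ∀ w ∈ Set.Icc (0 : Fin n → ℝ) 1,
    (∀ i, w i < v i) → ¬ r w v
  upper_closed : ∀ x : ℕ → Fin n → ℝ, (∀ t, x t ∈ Set.Icc (0 : Fin n → ℝ) 1) →
    ∀ v ∈ Set.Icc (0 : Fin n → ℝ) 1, ∀ w ∈ Set.Icc (0 : Fin n → ℝ) 1,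
      Tendsto x atTop (𝓝 v) → (∀ t, r (x t) w) → r v w
  lower_closed : ∀ x : ℕ → Fin n → ℝ, (∀ t, x t ∈ Set.Icc (0 : Fin n → ℝ) 1) →
    ∀ v ∈ Set.Icc (0 : Fin n → ℝ) 1, ∀ w ∈ Set.Icc (0 : Fin n → ℝ) 1,
      Tendsto x atTop (𝓝 v) → (∀ t, r w (x t)) → r w v
  translate : ∀ v ∈ Set.Icc (0 : Fin n → ℝ) 1, ∀ w ∈ Set.Icc (0 : Fin n → ℝ) 1, ∀ c : ℝ,
    (fun i => v i + c) ∈ Set.Icc (0 : Fin n → ℝ) 1 →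
    (fun i => w i + c) ∈ Set.Icc (0 : Fin n → ℝ) 1 →
    r v w → r (fun i => v i + c) (fun i => w i + c)
  midpoint : ∀ v ∈ Set.Icc (0 : Fin n → ℝ) 1, ∀ w ∈ Set.Icc (0 : Fin n → ℝ) 1,
    r (fun i => (v i + w i) / 2) v ∨ r (fun i => (v i + w i) / 2) w

theorem const_mem_cube {c : ℝ} (hc : c ∈ Set.Icc (0 : ℝ) 1) :
    (fun _ => c) ∈ Set.Icc (0 : Fin n → ℝ) 1 :=
  ⟨fun _ => hc.1, fun _ => hc.2⟩

namespace IsCubeOrder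

variable {r : (Fin n → ℝ) → (Fin n → ℝ) → Prop}

/-- The constants weakly below and weakly above `v` form closed nonempty sets covering the connected
unit interval, hence they meet. -/
theorem exists_const_equiv (hr : IsCubeOrder r) {v : Fin n → ℝ}
    (hv : v ∈ Set.Icc (0 : Fin n → ℝ) 1) :
    ∃ c ∈ Set.Icc (0 : ℝ) 1, r v (fun _ => c) ∧ r (fun _ => c) v := by
  let A : Set ℝ := {c | c ∈ Set.Icc (0 : ℝ) 1 ∧ r v (fun _ => c)}
  let B : Set ℝ := {c | c ∈ Set.Icc (0 : ℝ) 1 ∧ r (fun _ => c) v}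
  have hconst : ∀ (x : ℕ → ℝ) (a : ℝ), Tendsto x atTop (𝓝 a) →
      Tendsto (fun t => (fun _ => x t : Fin n → ℝ)) atTop (𝓝 fun _ => a) := fun x a h =>
    tendsto_pi_nhds.2 fun _ => h
  have hA : IsClosed A := by
    refine IsSeqClosed.isClosed fun x a hx hlim => ?_
    have ha : a ∈ Set.Icc (0 : ℝ) 1 := isClosed_Icc.mem_of_tendsto hlim
      (Eventually.of_forall fun t => (hx t).1)
    exact ⟨ha, hr.lower_closed _ (fun t => const_mem_cube (hx t).1) _ (const_mem_cube ha) _ hv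
      (hconst x a hlim) fun t => (hx t).2⟩
  have hB : IsClosed B := by
    refine IsSeqClosed.isClosed fun x a hx hlim => ?_
    have ha : a ∈ Set.Icc (0 : ℝ) 1 := isClosed_Icc.mem_of_tendsto hlim
      (Eventually.of_forall fun t => (hx t).1)
    exact ⟨ha, hr.upper_closed _ (fun t => const_mem_cube (hx t).1) _ (const_mem_cube ha) _ hv
      (hconst x a hlim) fun t => (hx t).2⟩
  have h0 : (0 : ℝ) ∈ Set.Icc (0 : ℝ) 1 := by simp
  have h1 : (1 : ℝ) ∈ Set.Icc (0 : ℝ) 1 := by simp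
  obtain ⟨c, hc, hcA, hcB⟩ := isPreconnected_closed_iff.1 (isPreconnected_Icc (a := (0 : ℝ)) (b := 1))
    A B hA hB (fun c hc => (hr.total v hv _ (const_mem_cube hc)).imp (fun h => ⟨hc, h⟩)
      fun h => ⟨hc, h⟩)
    ⟨0, h0, h0, hr.mono _ hv _ (const_mem_cube h0) hv.1⟩
    ⟨1, h1, h1, hr.mono _ (const_mem_cube h1) _ hv hv.2⟩
  exact ⟨c, hc, hcA.2, hcB.2⟩

/-- `W v` is the equivalent constant, unique because larger constants are strictly better; each
property of `W` is the matching property of the order, carried over by this uniqueness. -/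
theorem exists_isCubeWelfare (hr : IsCubeOrder r) [NeZero n] :
    ∃ W : (Fin n → ℝ) → ℝ, IsCubeWelfare W ∧ ∀ v ∈ Set.Icc (0 : Fin n → ℝ) 1,
      ∀ w ∈ Set.Icc (0 : Fin n → ℝ) 1, (r v w ↔ W w ≤ W v) := by
  have hex : ∀ v : Fin n → ℝ, ∃ c : ℝ, v ∈ Set.Icc (0 : Fin n → ℝ) 1 →
      c ∈ Set.Icc (0 : ℝ) 1 ∧ r v (fun _ => c) ∧ r (fun _ => c) v := by
    intro v
    by_cases hv : v ∈ Set.Icc (0 : Fin n → ℝ) 1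
    · obtain ⟨c, h⟩ := hr.exists_const_equiv hv
      exact ⟨c, fun _ => h⟩
    · exact ⟨0, fun h => absurd h hv⟩
  choose W hW using hex
  have hcc : ∀ c ∈ Set.Icc (0 : ℝ) 1, ∀ d ∈ Set.Icc (0 : ℝ) 1,
      (r (fun _ => c) (fun _ => d) ↔ d ≤ c) := fun c hc d hd => by
    constructor
    · intro h
      by_contra! hlt
      exact hr.strict _ (const_mem_cube hd) _ (const_mem_cube hc) (fun _ => hlt) h
    · exact fun h => hr.mono _ (const_mem_cube hc) _ (const_mem_cube hd) fun _ => h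
  have hrep : ∀ v ∈ Set.Icc (0 : Fin n → ℝ) 1, ∀ w ∈ Set.Icc (0 : Fin n → ℝ) 1,
      (r v w ↔ W w ≤ W v) := fun v hv w hw => by
    obtain ⟨hcv, hv1, hv2⟩ := hW v hv
    obtain ⟨hcw, hw1, hw2⟩ := hW w hw
    have hcv' := const_mem_cube (n := n) hcv
    have hcw' := const_mem_cube (n := n) hcw
    rw [← hcc _ hcv _ hcw]
    exact ⟨fun h => hr.trans _ hcv' v hv _ hcw' hv2 (hr.trans v hv w hw _ hcw' h hw1),
      fun h => hr.trans v hv _ hcv' w hw hv1 (hr.trans _ hcv' _ hcw' w hw h hw2)⟩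
  have huniq : ∀ v ∈ Set.Icc (0 : Fin n → ℝ) 1, ∀ c ∈ Set.Icc (0 : ℝ) 1, r v (fun _ => c) →
      r (fun _ => c) v → W v = c := fun v hv c hc h1 h2 => by
    obtain ⟨hcv, hv1, hv2⟩ := hW v hv
    exact le_antisymm
      ((hcc _ hc _ hcv).1 (hr.trans _ (const_mem_cube hc) v hv _ (const_mem_cube hcv) h2 hv1))
      ((hcc _ hcv _ hc).1 (hr.trans _ (const_mem_cube hcv) v hv _ (const_mem_cube hc) hv2 h1))
  have hmono : ∀ v ∈ Set.Icc (0 : Fin n → ℝ) 1, ∀ w ∈ Set.Icc (0 : Fin n → ℝ) 1, v ≤ w →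
      W v ≤ W w := fun v hv w hw h => (hrep w hw v hv).1 (hr.mono w hw v hv h)
  refine ⟨W, ⟨fun c hc => ?_, hmono, fun v hv c hvc => ?_, fun v hv w hw => ?_⟩, hrep⟩
  · exact huniq _ (const_mem_cube hc) c hc (hr.mono _ (const_mem_cube hc) _ (const_mem_cube hc) le_rfl)
      (hr.mono _ (const_mem_cube hc) _ (const_mem_cube hc) le_rfl)
  · obtain ⟨hcv, hv1, hv2⟩ := hW v hv
    have hWc : W v + c ∈ Set.Icc (0 : ℝ) 1 := by
      -- `W v` lies between the least and the greatest coordinate of `v`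
      obtain ⟨i, hi⟩ := Finite.exists_min v
      obtain ⟨j, hj⟩ := Finite.exists_max v
      have hvi : v i ≤ W v := by
        refine (hcc _ hcv _ ⟨hv.1 i, hv.2 i⟩).1 (hr.trans _ (const_mem_cube hcv) v hv _
          (const_mem_cube ⟨hv.1 i, hv.2 i⟩) hv2 (hr.mono v hv _ (const_mem_cube ⟨hv.1 i, hv.2 i⟩) hi))
      have hvj : W v ≤ v j := by
        refine (hcc _ ⟨hv.1 j, hv.2 j⟩ _ hcv).1 (hr.trans _ (const_mem_cube ⟨hv.1 j, hv.2 j⟩) v hv _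
          (const_mem_cube hcv) (hr.mono _ (const_mem_cube ⟨hv.1 j, hv.2 j⟩) v hv hj) hv1)
      have h0 : 0 ≤ v i + c := hvc.1 i
      have h1 : v j + c ≤ 1 := hvc.2 j
      constructor <;> linarith
    exact huniq _ hvc _ hWc
      (hr.translate v hv _ (const_mem_cube hcv) c hvc (const_mem_cube hWc) hv1)
      (hr.translate _ (const_mem_cube hcv) v hv c (const_mem_cube hWc) hvc hv2)
  · have hm : (fun i => (v i + w i) / 2) ∈ Set.Icc (0 : Fin n → ℝ) 1 := by
      constructor
      · intro i
        have := hv.1 i; have := hw.1 i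
        simp only [Pi.zero_apply] at *
        linarith
      · intro i
        have := hv.2 i; have := hw.2 i
        simp only [Pi.one_apply] at *
        linarith
    rcases hr.midpoint v hv w hw with h | h
    · exact (min_le_left _ _).trans ((hrep _ hm _ hv).1 h)
    · exact (min_le_right _ _).trans ((hrep _ hm _ hw).1 h)

end IsCubeOrder

end Variational

/-! ### Elementary properties of the variational minimum. -/

section VariationalMin

variable {n : ℕ} {φ : (Fin n → ℝ) → ℝ≥0∞}

theorem IsVariationalMin.exists_eq {v : Fin n → ℝ} {w : ℝ} (h : IsVariationalMin φ v w) :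
    ∃ μ ∈ stdSimplex ℝ (Fin n), ∃ a : ℝ≥0, φ μ = a ∧ ∑ i, μ i * v i + a = w := by
  obtain ⟨⟨μ, hμ, he⟩, -⟩ := h
  simp only at he
  have hfin : φ μ ≠ ∞ := by
    intro htop
    rw [htop, EReal.coe_ennreal_top, EReal.coe_add_top] at he
    exact EReal.coe_ne_top _ he.symm
  lift φ μ to ℝ≥0 using hfin with a ha
  refine ⟨μ, hμ, a, ha.symm, ?_⟩
  have e : ((a : ℝ≥0∞) : EReal) = ((a : ℝ) : EReal) := rfl
  rw [e, ← EReal.coe_add] at he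
  exact_mod_cast he

theorem IsVariationalMin.le {v : Fin n → ℝ} {w : ℝ} (h : IsVariationalMin φ v w) {μ : Fin n → ℝ}
    (hμ : μ ∈ stdSimplex ℝ (Fin n)) {a : ℝ≥0} (ha : φ μ = a) : w ≤ ∑ i, μ i * v i + a := by
  have hle := h.2 ⟨μ, hμ, rfl⟩
  simp only at hle
  have e : ((a : ℝ≥0∞) : EReal) = ((a : ℝ) : EReal) := rfl
  rw [ha, e, ← EReal.coe_add] at hle
  exact_mod_cast hle

/-- Weights minimizing at `v` are feasible at `v'`, and they sum to one, so a coordinatewise bound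
`c` passes to the values. Uniqueness, strict monotonicity, translation and continuity are all
instances. -/
theorem IsVariationalMin.le_add {v v' : Fin n → ℝ} {w w' : ℝ} (h : IsVariationalMin φ v w)
    (h' : IsVariationalMin φ v' w') {c : ℝ} (hc : ∀ i, v' i ≤ v i + c) : w' ≤ w + c := by
  obtain ⟨μ, hμ, a, ha, rfl⟩ := h.exists_eq
  have h1 := h'.le hμ ha
  have h2 : ∑ i, μ i * v' i ≤ ∑ i, μ i * v i + c := by
    calc ∑ i, μ i * v' i ≤ ∑ i, (μ i * v i + μ i * c) := Finset.sum_le_sum fun i _ => by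
          rw [← mul_add]
          exact mul_le_mul_of_nonneg_left (hc i) (hμ.1 i)
      _ = ∑ i, μ i * v i + c := by
          rw [Finset.sum_add_distrib, ← Finset.sum_mul, hμ.2, one_mul]
  linarith

theorem IsVariationalMin.unique {v : Fin n → ℝ} {w w' : ℝ} (h : IsVariationalMin φ v w)
    (h' : IsVariationalMin φ v w') : w = w' := by
  have h1 := h.le_add h' (c := 0) fun i => by simp
  have h2 := h'.le_add h (c := 0) fun i => by simp
  linarith

theorem IsVariationalMin.lt [NeZero n] {v v' : Fin n → ℝ} {w w' : ℝ}
    (h : IsVariationalMin φ v w) (h' : IsVariationalMin φ v' w') (hlt : ∀ i, v' i < v i) :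
    w' < w := by
  obtain ⟨j, hj⟩ := Finite.exists_min fun i => v i - v' i
  have := h.le_add h' (c := -(v j - v' j)) fun i => by linarith [hj i]
  linarith [hlt j]

theorem IsVariationalMin.eq_add {v v' : Fin n → ℝ} {w w' : ℝ} (h : IsVariationalMin φ v w)
    (h' : IsVariationalMin φ v' w') {c : ℝ} (hc : ∀ i, v' i = v i + c) : w' = w + c := by
  have h1 := h.le_add h' (c := c) fun i => (hc i).le
  have h2 := h'.le_add h (c := -c) fun i => by rw [hc i]; linarith
  linarith

/-- The weights minimizing at the midpoint are tested at both endpoints. -/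
theorem IsVariationalMin.add_le_midpoint {v v' m : Fin n → ℝ} {w w' z : ℝ}
    (h : IsVariationalMin φ v w) (h' : IsVariationalMin φ v' w') (hm : IsVariationalMin φ m z)
    (hmid : ∀ i, m i = (v i + v' i) / 2) : w + w' ≤ 2 * z := by
  obtain ⟨μ, hμ, a, ha, rfl⟩ := hm.exists_eq
  have h1 := h.le hμ ha
  have h2 := h'.le hμ ha
  have h3 : 2 * ∑ i, μ i * m i = ∑ i, μ i * v i + ∑ i, μ i * v' i := by
    rw [Finset.mul_sum, ← Finset.sum_add_distrib]
    exact Finset.sum_congr rfl fun i _ => by rw [hmid i]; ring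
  linarith

theorem IsVariationalMin.tendsto {v : ℕ → Fin n → ℝ} {w : ℕ → ℝ} {v₀ : Fin n → ℝ} {w₀ : ℝ}
    (h : ∀ t, IsVariationalMin φ (v t) (w t)) (h₀ : IsVariationalMin φ v₀ w₀)
    (hv : Tendsto v atTop (𝓝 v₀)) : Tendsto w atTop (𝓝 w₀) := by
  rw [tendsto_iff_dist_tendsto_zero] at hv ⊢
  refine squeeze_zero (fun _ => dist_nonneg) (fun t => ?_) hv
  have hd : ∀ i, |v t i - v₀ i| ≤ dist (v t) v₀ := fun i => dist_le_pi_dist (v t) v₀ i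
  have h1 := (h t).le_add h₀ (c := dist (v t) v₀) fun i => by linarith [(abs_le.1 (hd i)).1]
  have h2 := h₀.le_add (h t) (c := dist (v t) v₀) fun i => by linarith [(abs_le.1 (hd i)).2]
  rw [Real.dist_eq, abs_le]
  constructor <;> linarith

end VariationalMin

/-! ### From the axioms to an order on the cube, and back. -/

section Representation

variable {Ω : Type*} [MeasurableSpace Ω] {𝕏 : Type*} {n : ℕ} {X : Menu 𝕏}

theorem Profile.normUtil_betAct (P : Profile Ω n X) (x y : X.Outcome) {E : Set Ω}
    (hE : MeasurableSet E) (i : Fin n) :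
    P.normUtil (betAct x E hE y) i =
      P.normValue i y + (P.belief i).real E * (P.normValue i x - P.normValue i y) :=
  seu_betAct _ _ _ _ _

theorem Profile.IsPseudoMix.normUtil {P : Profile Ω n X} {α : ℝ} {f h : Act Ω X} {x : X.Outcome}
    (hm : P.IsPseudoMix α f x h) (i : Fin n) :
    P.normUtil h i = α * P.normUtil f i + (1 - α) * P.normValue i x := by
  classical
  let S : Finset X.Outcome := insert x (f.range ∪ h.range)
  have hf : ∀ ω, f ω ∈ S := fun ω => by simp [S]
  have hh : ∀ ω, h ω ∈ S := fun ω => by simp [S]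
  rw [Profile.normUtil, Profile.normUtil, seu_eq_sum _ _ f hf, seu_eq_sum _ _ h hh,
    Finset.mul_sum]
  have hterm : ∀ y ∈ S, (P.belief i).real (h ⁻¹' {y}) * P.normValue i y =
      α * ((P.belief i).real (f ⁻¹' {y}) * P.normValue i y) +
        if y = x then (1 - α) * P.normValue i x else 0 := by
    intro y _
    rw [hm i y]
    split_ifs with hy
    · subst hy; ring
    · ring
  rw [Finset.sum_congr rfl hterm, Finset.sum_add_distrib, Finset.sum_ite_eq' S x,
    if_pos (Finset.mem_insert_self _ _)]

theorem betAct_preimage_left {x y : X.Outcome} (hxy : x ≠ y) {E : Set Ω} (hE : MeasurableSet E) :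
    betAct x E hE y ⁻¹' {x} = E := by
  ext ω
  by_cases hω : ω ∈ E <;> simp [betAct, hω, hxy.symm]

theorem betAct_preimage_right {x y : X.Outcome} (hxy : x ≠ y) {E : Set Ω}
    (hE : MeasurableSet E) : betAct x E hE y ⁻¹' {y} = Eᶜ := by
  ext ω
  by_cases hω : ω ∈ E <;> simp [betAct, hω, hxy]

/-- Mixing a bet with its losing prize only scales the winning probability; mixing with the winning
prize, as in `isPseudoMix_betAct_left`, also adds `1 - α` to it. -/
theorem isPseudoMix_betAct_right {P : Profile Ω n X} {x y : X.Outcome} (hxy : x ≠ y)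
    (hall : ∀ z, z = x ∨ z = y) {E F : Set Ω} (hE : MeasurableSet E) (hF : MeasurableSet F)
    {α : ℝ} (h : ∀ i, (P.belief i).real F = α * (P.belief i).real E) :
    P.IsPseudoMix α (betAct x E hE y) y (betAct x F hF y) := by
  intro i z
  rcases hall z with rfl | rfl
  · rw [if_neg hxy, betAct_preimage_left hxy, betAct_preimage_left hxy, h]
  · rw [if_pos rfl, betAct_preimage_right hxy, betAct_preimage_right hxy,
      probReal_compl_eq_one_sub hE, probReal_compl_eq_one_sub hF, h]
    ring

theorem isPseudoMix_betAct_left {P : Profile Ω n X} {x y : X.Outcome} (hxy : x ≠ y)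
    (hall : ∀ z, z = x ∨ z = y) {E F : Set Ω} (hE : MeasurableSet E) (hF : MeasurableSet F)
    {α : ℝ} (h : ∀ i, (P.belief i).real F = α * (P.belief i).real E + (1 - α)) :
    P.IsPseudoMix α (betAct x E hE y) x (betAct x F hF y) := by
  intro i z
  rcases hall z with rfl | rfl
  · rw [if_pos rfl, betAct_preimage_left hxy, betAct_preimage_left hxy, h]
  · rw [if_neg hxy.symm, betAct_preimage_right hxy, betAct_preimage_right hxy,
      probReal_compl_eq_one_sub hE, probReal_compl_eq_one_sub hF, h]
    ring

namespace AggregationRule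

variable {R : AggregationRule Ω 𝕏 n}

theorem axioms_of_representation [NeZero n] {φ : (Fin n → ℝ) → ℝ≥0∞}
    (h : ∀ (X : Menu 𝕏) (P : Profile Ω n X), ∃ W : Act Ω X → ℝ,
      (∀ f, IsVariationalMin φ (P.normUtil f) (W f)) ∧ ∀ f g, R.rel P f g ↔ W f ≥ W g) :
    R.Pareto ∧ R.Continuity ∧ R.IIE ∧ R.WeakPrefMixing ∧ R.BeliefIrrelevance ∧
      R.WeakRestrictedCertaintyIndep := by
  refine ⟨fun X P f g => ?_, fun X P f g F hF => ?_, fun X X' P P' hXX hP f g => ?_,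
    fun X P x y E hE hc => ?_, fun X P P' hv x y => ?_,
    fun X P hcv f g x y α _ _ fx gx fy gy hfx hgx hfy hgy => ?_⟩
  · obtain ⟨W, hW, hR⟩ := h X P
    simp only [hR, P.pref_iff_normUtil]
    refine ⟨fun hle => ?_, fun hlt => ?_⟩
    · simpa using (hW f).le_add (hW g) (c := 0) fun i => by simpa using hle i
    · have := (hW f).lt (hW g) fun i => not_le.1 (hlt i).2
      exact ⟨this.le, not_le.2 this⟩
  · obtain ⟨W, hW, hR⟩ := h X P
    have hlim := IsVariationalMin.tendsto (fun t => hW (F t)) (hW f) hF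
    simp only [hR]
    exact ⟨fun hg => ge_of_tendsto' hlim hg, fun hg => le_of_tendsto' hlim hg⟩
  · obtain ⟨W, hW, hR⟩ := h X P
    obtain ⟨W', hW', hR'⟩ := h X' P'
    have hW'' : ∀ f, W' (embAct hXX f) = W f := fun f => by
      have := hW' (embAct hXX f)
      rw [hP.extends.normUtil] at this
      exact this.unique (hW f)
    rw [hR, hR', hW'', hW'']
  · obtain ⟨W, hW, hR⟩ := h X P
    have := (hW (constAct Ω x)).add_le_midpoint (hW (constAct Ω y)) (hW (betAct x E hE y))
      fun i => by
        rw [P.normUtil_betAct, hc i, P.normUtil_constAct, P.normUtil_constAct]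
        ring
    rw [hR, hR]
    by_contra! hlt
    linarith
  · obtain ⟨W, hW, hR⟩ := h X P
    obtain ⟨W', hW', hR'⟩ := h X P'
    have hWW : ∀ x, W' (constAct Ω x) = W (constAct Ω x) := fun x => by
      have h1 := hW (constAct Ω x)
      rw [show P.normUtil (constAct Ω x) = P'.normUtil (constAct Ω x) from funext fun i => by
        rw [P.normUtil_constAct, P'.normUtil_constAct, hv]] at h1
      exact (hW' _).unique h1
    rw [hR, hR', hWW, hWW]
  · obtain ⟨W, hW, hR⟩ := h X P
    -- With common values, replacing `x` by `y` in the mixture shifts every coordinate by the same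
    -- amount, which does not depend on the act mixed.
    have key : ∀ k kx ky : Act Ω X, P.IsPseudoMix α k x kx → P.IsPseudoMix α k y ky →
        W ky = W kx + (1 - α) * (P.normValue 0 y - P.normValue 0 x) := fun k kx ky hx hy =>
      (hW kx).eq_add (hW ky) fun i => by
        rw [hx.normUtil, hy.normUtil, hcv i 0]
        ring
    rw [hR, hR, key f fx fy hfx hfy, key g gx gy hgx hgy]
    simp

theorem exists_isCubeOrder [Infinite 𝕏] [NeZero n] (hPar : R.Pareto) (hCont : R.Continuity)
    (hIIE : R.IIE) (hMix : R.WeakPrefMixing) (hBel : R.BeliefIrrelevance)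
    (hCert : R.WeakRestrictedCertaintyIndep) {p₀ : Measure Ω} (hp₀ : IsBelief p₀) :
    ∃ r : (Fin n → ℝ) → (Fin n → ℝ) → Prop, IsCubeOrder r ∧
      ∀ (X : Menu 𝕏) (P : Profile Ω n X) (f g : Act Ω X),
        R.rel P f g ↔ r (P.normUtil f) (P.normUtil g) := by
  obtain ⟨p, hp, hrange⟩ := hp₀.exists_joint_range n
  have hex : ∀ v : Fin n → ℝ, ∃ E, MeasurableSet E ∧
      (v ∈ Set.Icc (0 : Fin n → ℝ) 1 → ∀ i, (p i).real E = v i) := by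
    intro v
    by_cases hv : v ∈ Set.Icc (0 : Fin n → ℝ) 1
    · obtain ⟨E, hE, h⟩ := hrange v fun i => ⟨hv.1 i, hv.2 i⟩
      exact ⟨E, hE, fun _ => h⟩
    · exact ⟨∅, MeasurableSet.empty, fun h => absurd h hv⟩
  choose E hE hpE using hex
  obtain ⟨e, -⟩ := exists_embedding_disjoint (𝕏 := 𝕏) Set.finite_empty 2
  -- A common-value problem in which `x` is worth 1 and `y` is worth 0 to everyone. The bet on an
  -- event then has the vector of its probabilities as utility vector, so bets fill the cube.
  let P := Profile.ofTable e (isTable_two (n := n)) hp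
  let x := Menu.enum e 0
  let y := Menu.enum e 1
  have hxy : x ≠ y := (Menu.enum e).injective.ne (by simp)
  have hall : ∀ z, z = x ∨ z = y := fun z => by
    obtain ⟨j, rfl⟩ := (Menu.enum e).surjective z
    fin_cases j
    · exact Or.inl rfl
    · exact Or.inr rfl
  have hPb : P.belief = p := Profile.belief_ofTable _ _ _
  have hPx : ∀ i, P.normValue i x = 1 := fun i => Profile.normValue_ofTable_enum _ _ _ i 0
  have hPy : ∀ i, P.normValue i y = 0 := fun i => Profile.normValue_ofTable_enum _ _ _ i 1
  have hPc : P.CommonValue := fun i j => funext fun z => by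
    rcases hall z with rfl | rfl
    · rw [hPx, hPx]
    · rw [hPy, hPy]
  let A : (Fin n → ℝ) → Act Ω (Menu.ofEmbedding e) := fun v => betAct x (E v) (hE v) y
  have hA : ∀ v ∈ Set.Icc (0 : Fin n → ℝ) 1, P.normUtil (A v) = v := fun v hv => funext fun i => by
    rw [P.normUtil_betAct, hPx, hPy, hPb, hpE v hv]
    ring
  have hrep : ∀ (X : Menu 𝕏) (Q : Profile Ω n X) (f g : Act Ω X),
      R.rel Q f g ↔ R.rel P (A (Q.normUtil f)) (A (Q.normUtil g)) := fun X Q f g =>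
    rel_iff_of_normUtil_eq hPar hIIE hBel Q P
      (hA _ ⟨fun i => (Q.normUtil_mem_Icc f i).1, fun i => (Q.normUtil_mem_Icc f i).2⟩).symm
      (hA _ ⟨fun i => (Q.normUtil_mem_Icc g i).1, fun i => (Q.normUtil_mem_Icc g i).2⟩).symm
  have htrans : ∀ v ∈ Set.Icc (0 : Fin n → ℝ) 1, ∀ w ∈ Set.Icc (0 : Fin n → ℝ) 1, ∀ c : ℝ, 0 < c →
      (fun i => v i + c) ∈ Set.Icc (0 : Fin n → ℝ) 1 →
      (fun i => w i + c) ∈ Set.Icc (0 : Fin n → ℝ) 1 →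
      (R.rel P (A v) (A w) ↔ R.rel P (A fun i => v i + c) (A fun i => w i + c)) := by
    intro v hv w hw c hc hvc hwc
    rcases lt_or_ge c 1 with hc1 | hc1
    · have hα : 0 < 1 - c := by linarith
      -- Both `z` and `z + c` come from mixing `z / (1 - c)` with weight `1 - c`, once with `y` and
      -- once with `x`; certainty independence compares exactly these. The division stays in the
      -- cube because `z + c` does.
      have hmix : ∀ z ∈ Set.Icc (0 : Fin n → ℝ) 1, (fun i => z i + c) ∈ Set.Icc (0 : Fin n → ℝ) 1 →
          P.IsPseudoMix (1 - c) (A fun i => z i / (1 - c)) y (A z) ∧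
          P.IsPseudoMix (1 - c) (A fun i => z i / (1 - c)) x (A fun i => z i + c) := by
        intro z hz hzc
        have hdiv : (fun i => z i / (1 - c)) ∈ Set.Icc (0 : Fin n → ℝ) 1 :=
          ⟨fun i => div_nonneg (hz.1 i) hα.le, fun i => (div_le_one hα).2 (by
            have : z i + c ≤ 1 := hzc.2 i
            linarith)⟩
        refine ⟨isPseudoMix_betAct_right hxy hall _ _ fun i => ?_,
          isPseudoMix_betAct_left hxy hall _ _ fun i => ?_⟩
        · rw [hPb, hpE _ hz, hpE _ hdiv]
          field_simp
        · rw [hPb, hpE _ hzc, hpE _ hdiv]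
          field_simp
          ring
      exact hCert _ P hPc _ _ y x (1 - c) hα (by linarith) _ _ _ _ (hmix v hv hvc).1
        (hmix w hw hwc).1 (hmix v hv hvc).2 (hmix w hw hwc).2
    -- A shift by at least 1 is possible only from the zero vector, so the two vectors coincide.
    · have hzero : ∀ z ∈ Set.Icc (0 : Fin n → ℝ) 1,
          (fun i => z i + c) ∈ Set.Icc (0 : Fin n → ℝ) 1 → z = 0 := fun z hz hzc => funext fun i => by
        have h1 : z i + c ≤ 1 := hzc.2 i
        have h2 : 0 ≤ z i := hz.1 i
        simp only [Pi.zero_apply]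
        linarith
      rw [hzero v hv hvc, hzero w hw hwc]
      exact ⟨fun _ => hPar.rel_of_le P le_rfl, fun _ => hPar.rel_of_le P le_rfl⟩
  refine ⟨fun v w => R.rel P (A v) (A w), ?_, hrep⟩
  refine ⟨fun v _ w _ => R.complete P _ _, fun v _ w _ z _ => R.transitive P _ _ _,
    fun v hv w hw hle => hPar.rel_of_le P (by rwa [hA v hv, hA w hw]), fun v hv w hw hlt => ?_,
    fun z hz v hv w hw hlim h => ?_, fun z hz v hv w hw hlim h => ?_,
    fun v hv w hw c hvc hwc h => ?_, fun v hv w hw => ?_⟩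
  · refine ((hPar _ P (A v) (A w)).2 fun i => ?_).2
    rw [P.pref_iff_normUtil, P.pref_iff_normUtil, hA v hv, hA w hw]
    exact ⟨(hlt i).le, not_le.2 (hlt i)⟩
  · refine (hCont _ P (A v) (A w) (fun t => A (z t)) ?_).1 h
    simp only [hA _ (hz _), hA v hv]
    exact hlim
  · refine (hCont _ P (A v) (A w) (fun t => A (z t)) ?_).2 h
    simp only [hA _ (hz _), hA v hv]
    exact hlim
  · rcases lt_trichotomy c 0 with hc | rfl | hc
    · have := htrans _ hvc _ hwc (-c) (by linarith) (by simpa using hv) (by simpa using hw)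
      simp only [add_neg_cancel_right] at this
      exact this.2 h
    · simpa using h
    · exact (htrans v hv w hw c hc hvc hwc).1 h
  -- The mixing axiom concerns outcomes, so `v` and `w` must be utility vectors of outcomes here. A
  -- four-outcome menu with the same beliefs provides them, and the event with all probabilities `1
  -- / 2` is the coin.
  · have hT := isTable_four (fun i => ⟨hv.1 i, hv.2 i⟩ : ∀ i, v i ∈ Set.Icc (0 : ℝ) 1)
      (fun i => ⟨hw.1 i, hw.2 i⟩ : ∀ i, w i ∈ Set.Icc (0 : ℝ) 1)
    obtain ⟨e', -⟩ := exists_embedding_disjoint (𝕏 := 𝕏) Set.finite_empty 4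
    let Q := Profile.ofTable e' hT hp
    have hhalf : (fun _ => (1 / 2 : ℝ)) ∈ Set.Icc (0 : Fin n → ℝ) 1 :=
      const_mem_cube ⟨by norm_num, by norm_num⟩
    have hQb : Q.belief = p := Profile.belief_ofTable _ _ _
    have hQv : ∀ i, Q.normValue i (Menu.enum e' 0) = v i := fun i =>
      Profile.normValue_ofTable_enum _ _ _ i 0
    have hQw : ∀ i, Q.normValue i (Menu.enum e' 1) = w i := fun i =>
      Profile.normValue_ofTable_enum _ _ _ i 1
    have hcoin : Q.IsCoinToss (E fun _ => 1 / 2) := fun i => by rw [hQb, hpE _ hhalf]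
    have h := hMix _ Q (Menu.enum e' 0) (Menu.enum e' 1) _ (hE _) hcoin
    rw [hrep _ Q, hrep _ Q] at h
    have h0 : Q.normUtil (constAct Ω (Menu.enum e' 0)) = v := funext fun i => by
      rw [Q.normUtil_constAct, hQv]
    have h1 : Q.normUtil (constAct Ω (Menu.enum e' 1)) = w := funext fun i => by
      rw [Q.normUtil_constAct, hQw]
    have hm : Q.normUtil (betAct (Menu.enum e' 0) _ (hE fun _ => 1 / 2) (Menu.enum e' 1)) =
        fun i => (v i + w i) / 2 := funext fun i => by
      rw [Q.normUtil_betAct, hQv, hQw, hcoin i]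
      ring
    rwa [h0, h1, hm] at h

end AggregationRule

end Representation

end SocialChoice

theorem theorem6 {Ω 𝕏 : Type*} [MeasurableSpace Ω] [Infinite Ω] [Infinite 𝕏] {n : ℕ} (hn : 2 ≤ n)
    (R : SocialChoice.AggregationRule Ω 𝕏 n) :
    (R.Pareto ∧ R.Continuity ∧ R.IIE ∧ R.WeakPrefMixing ∧ R.BeliefIrrelevance ∧
        R.WeakRestrictedCertaintyIndep) ↔
      ∃ φ : (Fin n → ℝ) → ℝ≥0∞,
        SocialChoice.Grounded φ ∧
        ConvexOn ℝ≥0 (stdSimplex ℝ (Fin n)) φ ∧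
        LowerSemicontinuousOn φ (stdSimplex ℝ (Fin n)) ∧
        ∀ (X : SocialChoice.Menu 𝕏) (P : SocialChoice.Profile Ω n X),
          ∃ W : SocialChoice.Act Ω X → ℝ,
            (∀ f, SocialChoice.IsVariationalMin φ (P.normUtil f) (W f)) ∧
            ∀ f g, R.rel P f g ↔ W f ≥ W g := by
  have : NeZero n := ⟨by omega⟩
  constructor
  · rintro ⟨hPar, hCont, hIIE, hMix, hBel, hCert⟩
    -- If `Ω` carries no nonatomic probability measure, there are no profiles at all, and the zero
    -- penalty serves vacuously.
    by_cases hex : ∃ p : MeasureTheory.Measure Ω, SocialChoice.IsBelief p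
    · obtain ⟨p, hp⟩ := hex
      obtain ⟨r, hr, hrep⟩ := SocialChoice.AggregationRule.exists_isCubeOrder hPar hCont hIIE hMix
        hBel hCert hp
      obtain ⟨W, hW, hrW⟩ := hr.exists_isCubeWelfare
      have hcube : ∀ (X : SocialChoice.Menu 𝕏) (P : SocialChoice.Profile Ω n X) f,
          P.normUtil f ∈ Set.Icc (0 : Fin n → ℝ) 1 := fun X P f =>
        ⟨fun i => (P.normUtil_mem_Icc f i).1, fun i => (P.normUtil_mem_Icc f i).2⟩
      exact ⟨SocialChoice.cubePenalty W, hW.grounded_cubePenalty,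
        SocialChoice.convexOn_cubePenalty W,
        (SocialChoice.lowerSemicontinuous_cubePenalty W).lowerSemicontinuousOn _,
        fun X P => ⟨fun f => W (P.normUtil f), fun f => hW.isVariationalMin (hcube X P f),
          fun f g => by rw [hrep, hrW _ (hcube X P f) _ (hcube X P g)]⟩⟩
    · refine ⟨fun _ => 0, ?_, ⟨?_, by simp⟩, ?_, fun X P =>
        absurd ⟨_, (P.isSEURep 0).belief⟩ hex⟩
      · exact le_antisymm (iInf₂_le _ (single_mem_stdSimplex ℝ (0 : Fin n))) bot_le
      · exact (SocialChoice.convexOn_cubePenalty fun _ : Fin n → ℝ => 0).1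
      · exact lowerSemicontinuousOn_const
  · rintro ⟨φ, -, -, -, h⟩
    exact SocialChoice.AggregationRule.axioms_of_representation h
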